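/- Let $0<p<1$, $0<q<1$ and let $L\ge 1$ be an integer. Let $(X_k)_{k\ge 0}$ be the random walk on $\mathbb Z$ with memory $L$, perturbed at its $L$-extrema; that is, $X_0$ is an arbitrary (possibly random) integer and, for every $k\ge 0$, given $X_0,\dots,X_k$ with $X_k=x$, the next position $X_{k+1}$ is $x+1$ with conditional probability $$ \begin{cases} \tfrac12, & \text{if } k=0,\\ p, & \text{if } k\ge 1 \text{ and } x=\max_{0\le m\le \min(L,k)}X_{k-m},\\ q, & \text{if } k\ge 1 \text{ and } x=\min_{0\le m\le \min(L,k)}X_{k-m},\\ \tfrac12, & \text{otherwise}, \end{cases} $$ and is $x-1$ with the complementary probability. Then: (i) the walk $(X_n)$ is recurrent (almost surely it visits every integer infinitely often) if and only if $p+q=1$; (ii) the Markov chain $(X_n,Y_n)_{n\ge L}$ on $\mathbb Z\times\{-1,1\}^L$, where $Y_n=(X_n-X_{n-1},\dots,X_{n-L+1}-X_{n-L})$, is recurrent (almost surely it visits every state infinitely often) if and only if $p+q=1$; (iii) if $p+q\ne 1$, then $|X_n|\to\infty$ almost surely. -/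

import Mathlib

open MeasureTheory Filter

/-- The current position `x k` is the maximum of `x` over the last `min L k` steps. -/
def IsLocalMaxAt (L : ℕ) (x : ℕ → ℤ) (k : ℕ) : Prop :=
  ∀ m ≤ min L k, x (k - m) ≤ x k

/-- The current position `x k` is the minimum of `x` over the last `min L k` steps. -/
def IsLocalMinAt (L : ℕ) (x : ℕ → ℤ) (k : ℕ) : Prop :=
  ∀ m ≤ min L k, x k ≤ x (k - m)

open Classical in
/-- The probability of a step to the right after time `k`, given the trajectory `x 0, …, x k`:
`p` at a local maximum, `q` at a local minimum, `1/2` otherwise, and also `1/2` if the position is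
both (for a nearest-neighbour path and `1 ≤ L` this happens only at `k = 0`). -/
noncomputable def rightProb (L : ℕ) (p q : ℝ) (x : ℕ → ℤ) (k : ℕ) : ℝ :=
  if IsLocalMaxAt L x k ∧ IsLocalMinAt L x k then 1 / 2
  else if IsLocalMaxAt L x k then p
  else if IsLocalMinAt L x k then q
  else 1 / 2

/-- `X` is, under `P`, a random walk on `ℤ` with finite memory `L`, perturbed at its `L`-extrema.
The starting point may be random. The two step conditions say that, given
`X 0 = x 0, …, X k = x k` (whenever this event has positive probability), the next position is
`x k + 1` with conditional probability `rightProb L p q x k` and `x k - 1` with the complementary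
probability. -/
structure IsPerturbedWalk {Ω : Type*} [MeasurableSpace Ω] (P : Measure Ω)
    (L : ℕ) (p q : ℝ) (X : ℕ → Ω → ℤ) : Prop where
  measurable : ∀ k, Measurable (X k)
  step_right : ∀ (k : ℕ) (x : ℕ → ℤ),
    P.real {ω | (∀ i ≤ k, X i ω = x i) ∧ X (k + 1) ω = x k + 1} =
      rightProb L p q x k * P.real {ω | ∀ i ≤ k, X i ω = x i}
  step_left : ∀ (k : ℕ) (x : ℕ → ℤ),
    P.real {ω | (∀ i ≤ k, X i ω = x i) ∧ X (k + 1) ω = x k - 1} =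
      (1 - rightProb L p q x k) * P.real {ω | ∀ i ≤ k, X i ω = x i}

/-- The walk is recurrent: almost surely, every site is visited infinitely often. -/
def WalkRecurrent {Ω : Type*} [MeasurableSpace Ω] (P : Measure Ω) (X : ℕ → Ω → ℤ) : Prop :=
  ∀ a : ℤ, ∀ᵐ ω ∂P, ∃ᶠ n in atTop, X n ω = a

/-- The last `L` steps before time `k` (used for `L ≤ k`), the most recent one first. -/
def lastSteps (L : ℕ) (x : ℕ → ℤ) (k : ℕ) : Fin L → ℤ :=
  fun i => x (k - i) - x (k - (i + 1))

/-- The chain of the pairs (position, last `L` steps), defined from time `L` on, is recurrent: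
almost surely, every state in `ℤ × {-1, 1}^L` is visited infinitely often. -/
def ChainRecurrent {Ω : Type*} [MeasurableSpace Ω] (P : Measure Ω) (L : ℕ)
    (X : ℕ → Ω → ℤ) : Prop :=
  ∀ (a : ℤ) (η : Fin L → ℤ), (∀ i, η i = 1 ∨ η i = -1) →
    ∀ᵐ ω ∂P, ∃ᶠ n in atTop, L ≤ n ∧ X n ω = a ∧ lastSteps L (fun k => X k ω) n = η

/-! The next step depends, from time `L` on, only on the last `L` steps, which form a Markov chain
on a finite set of windows. Solving the Poisson equation for the drift (`exists_poisson`) gives a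
bounded function `H` of the window and a mean drift `v` such that position plus `H` has conditional
mean increment exactly `v`.

If `p + q = 1`, reflection exchanges maxima and minima and preserves the step law, so
antisymmetrizing `H` gives a potential with `v = 0`. Position plus `H` is then a martingale with
bounded increments. It cannot converge, because long runs of right steps recur and raise it by `1`;
so it is unbounded on both sides, and a path with unit steps then hits every site infinitely often.
By a conditional Borel–Cantelli argument (`frequently_steps`), visits to a site are followed
infinitely often by any prescribed `L` steps, which handles the chain.

If `p + q ≠ 1`, compare with the symmetric walk with parameters `1 - q` and `q`, which has a
different step law only at maxima. Under the given walk, position plus the symmetric potential has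
drift `(p + q - 1) * advantage` at maxima and `0` elsewhere, so `v` has the sign of `p + q - 1` as
soon as the advantage is positive at maxima (`advantage_pos`). This is the crux. For `q ≤ 1/2` it
follows from a monotone coupling. For `q > 1/2` one follows two walks, one with an extra right step:
their step laws disagree only at discrepancies, and none occurs after a discrepancy followed by a
left step. This yields two inequalities between the least and the greatest advantage, which exclude
a nonpositive least one. Once `v ≠ 0`, a suitable exponential moment of position plus `H` decays
geometrically, which forces transience. -/

/-! ### Histories of steps and their step probabilities. -/

/-- The displacement `1` or `-1` of a step. -/
def stepSign (b : Bool) : ℤ := if b then 1 else -1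

/-- Adds a newest step to a stream of past steps. -/
def push (b : Bool) (w : ℕ → Bool) : ℕ → Bool
  | 0 => b
  | n + 1 => w n

/-- The total displacement over the `m` most recent steps. -/
def climb (w : ℕ → Bool) (m : ℕ) : ℤ := ∑ i ∈ Finset.range m, stepSign (w i)

/-- The current position is the maximum over the last `L` steps. -/
def WindowMax (L : ℕ) (w : ℕ → Bool) : Prop := ∀ m ≤ L, 0 ≤ climb w m

/-- The current position is the minimum over the last `L` steps. -/
def WindowMin (L : ℕ) (w : ℕ → Bool) : Prop := ∀ m ≤ L, climb w m ≤ 0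

open Classical in
/-- The probability of a step to the right after the history `w`. -/
noncomputable def upProb (L : ℕ) (p q : ℝ) (w : ℕ → Bool) : ℝ :=
  if WindowMax L w then p else if WindowMin L w then q else 1 / 2

/-- `H` solves the Poisson equation for the drift of the walk, with mean drift `v`. -/
structure IsPotential (L : ℕ) (p q v : ℝ) (H : (ℕ → Bool) → ℝ) : Prop where
  congr : ∀ w w' : ℕ → Bool, (∀ i < L, w i = w' i) → H w = H w'
  eq : ∀ w, upProb L p q w * (1 + H (push true w)) +
    (1 - upProb L p q w) * (-1 + H (push false w)) = H w + v

@[simp] theorem stepSign_true : stepSign true = 1 := rfl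
@[simp] theorem stepSign_false : stepSign false = -1 := rfl
@[simp] theorem push_zero (b : Bool) (w : ℕ → Bool) : push b w 0 = b := rfl
@[simp] theorem push_succ (b : Bool) (w : ℕ → Bool) (n : ℕ) : push b w (n + 1) = w n := rfl
@[simp] theorem climb_zero (w : ℕ → Bool) : climb w 0 = 0 := by simp [climb]

theorem climb_push (b : Bool) (w : ℕ → Bool) (m : ℕ) :
    climb (push b w) (m + 1) = stepSign b + climb w m := by
  simp [climb, Finset.sum_range_succ', add_comm]

theorem climb_succ (w : ℕ → Bool) (m : ℕ) :
    climb w (m + 1) = climb w m + stepSign (w m) := by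
  simp [climb, Finset.sum_range_succ]

theorem climb_congr {w w' : ℕ → Bool} {m : ℕ} (h : ∀ i < m, w i = w' i) :
    climb w m = climb w' m :=
  Finset.sum_congr rfl fun i hi => by rw [h i (Finset.mem_range.1 hi)]

theorem windowMax_congr {L : ℕ} {w w' : ℕ → Bool} (h : ∀ i < L, w i = w' i) :
    WindowMax L w ↔ WindowMax L w' :=
  forall₂_congr fun _ hm => by rw [climb_congr fun i hi => h i (hi.trans_le hm)]

theorem windowMin_congr {L : ℕ} {w w' : ℕ → Bool} (h : ∀ i < L, w i = w' i) :
    WindowMin L w ↔ WindowMin L w' :=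
  forall₂_congr fun _ hm => by rw [climb_congr fun i hi => h i (hi.trans_le hm)]

theorem upProb_congr {L : ℕ} {p q : ℝ} {w w' : ℕ → Bool} (h : ∀ i < L, w i = w' i) :
    upProb L p q w = upProb L p q w' := by
  classical
  unfold upProb
  rw [if_congr (windowMax_congr h) rfl (if_congr (windowMin_congr h) rfl rfl)]

theorem upProb_pos {L : ℕ} {p q : ℝ} (hp : 0 < p) (hq : 0 < q) (w : ℕ → Bool) :
    0 < upProb L p q w := by
  unfold upProb; split_ifs <;> linarith

theorem upProb_lt_one {L : ℕ} {p q : ℝ} (hp : p < 1) (hq : q < 1) (w : ℕ → Bool) :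
    upProb L p q w < 1 := by
  unfold upProb; split_ifs <;> linarith

theorem push_congr {b : Bool} {L : ℕ} {w w' : ℕ → Bool} (h : ∀ i < L, w i = w' i) :
    ∀ i < L + 1, push b w i = push b w' i := by
  rintro (_ | i) hi
  · rfl
  · exact h i (by omega)

/-! ### The Poisson equation on a finite chain. -/

section FiniteChain

variable {W : Type*} [Fintype W] (r : W → ℝ) (nxt : Bool → W → W)

/-- A superharmonic function on a finite chain is minimal at the state reached by repeated
`true`-moves. -/
theorem superharmonic_min (hr0 : ∀ w, 0 < r w) (hr1 : ∀ w, r w < 1) (N : ℕ) (w₀ : W)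
    (hreach : ∀ w, (nxt true)^[N] w = w₀) (d : W → ℝ)
    (hd : ∀ w, r w * d (nxt true w) + (1 - r w) * d (nxt false w) ≤ d w) (w : W) :
    d w₀ ≤ d w := by
  obtain ⟨u, -, hu⟩ := Finset.exists_min_image Finset.univ d ⟨w₀, Finset.mem_univ _⟩
  -- At a minimizer the averaging inequality is an equality, so its `true`-successor is a minimizer
  -- too.
  have hit : ∀ n, d ((nxt true)^[n] u) = d u := by
    intro n
    induction n with
    | zero => rfl
    | succ n ih =>
      rw [Function.iterate_succ_apply']
      set x := (nxt true)^[n] u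
      have h1 := hd x
      have h2 := hu (nxt true x) (Finset.mem_univ _)
      have h3 := hu (nxt false x) (Finset.mem_univ _)
      refine le_antisymm ?_ h2
      by_contra! hlt
      nlinarith [hr0 x, hr1 x, mul_pos (hr0 x) (sub_pos.2 hlt),
        mul_nonneg (sub_nonneg.2 (hr1 x).le) (sub_nonneg.2 h3)]
  rw [← hreach u, hit N]
  exact hu w (Finset.mem_univ _)

/-- The Poisson equation on a finite chain with a state reachable from everywhere. -/
theorem exists_poisson (hr0 : ∀ w, 0 < r w) (hr1 : ∀ w, r w < 1) (N : ℕ) (w₀ : W)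
    (hreach : ∀ w, (nxt true)^[N] w = w₀) (g : W → ℝ) :
    ∃ (h : W → ℝ) (v : ℝ),
      ∀ w, g w + r w * h (nxt true w) + (1 - r w) * h (nxt false w) = h w + v := by
  -- Adding evaluation at `w₀` to `1 - P`, with `P` the transition operator, removes the constants
  -- from the kernel. Surjectivity then follows by dimension, with `v = h w₀`.
  let A : (W → ℝ) →ₗ[ℝ] (W → ℝ) :=
    { toFun := fun φ w => φ w - (r w * φ (nxt true w) + (1 - r w) * φ (nxt false w)) + φ w₀
      map_add' := fun φ ψ => by ext w; simp only [Pi.add_apply]; ring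
      map_smul' := fun c φ => by
        ext w; simp only [Pi.smul_apply, smul_eq_mul, RingHom.id_apply]; ring }
  have hinj : Function.Injective A := by
    rw [injective_iff_map_eq_zero]
    intro φ hφ
    have he : ∀ w, φ w - (r w * φ (nxt true w) + (1 - r w) * φ (nxt false w)) + φ w₀ = 0 :=
      fun w => congrFun hφ w
    have hle : φ w₀ = 0 := by
      obtain ⟨u, -, hu⟩ := Finset.exists_min_image Finset.univ φ ⟨w₀, Finset.mem_univ _⟩
      obtain ⟨x, -, hx⟩ := Finset.exists_max_image Finset.univ φ ⟨w₀, Finset.mem_univ _⟩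
      have h1 := he u
      have h2 := he x
      have hu1 := hu (nxt true u) (Finset.mem_univ _)
      have hu2 := hu (nxt false u) (Finset.mem_univ _)
      have hx1 := hx (nxt true x) (Finset.mem_univ _)
      have hx2 := hx (nxt false x) (Finset.mem_univ _)
      apply le_antisymm
      · nlinarith [mul_nonneg (hr0 x).le (sub_nonneg.2 hx1),
          mul_nonneg (sub_nonneg.2 (hr1 x).le) (sub_nonneg.2 hx2)]
      · nlinarith [mul_nonneg (hr0 u).le (sub_nonneg.2 hu1),
          mul_nonneg (sub_nonneg.2 (hr1 u).le) (sub_nonneg.2 hu2)]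
    have hge := superharmonic_min r nxt hr0 hr1 N w₀ hreach φ (fun w => by linarith [he w])
    have hge' := superharmonic_min r nxt hr0 hr1 N w₀ hreach (fun w => - φ w)
      (fun w => by linarith [he w])
    ext w
    have h1 := hge w
    have h2 := hge' w
    simp only [Pi.zero_apply]
    linarith
  obtain ⟨h, hh⟩ := LinearMap.injective_iff_surjective.1 hinj g
  refine ⟨h, h w₀, fun w => ?_⟩
  have : h w - (r w * h (nxt true w) + (1 - r w) * h (nxt false w)) + h w₀ = g w := congrFun hh w
  linarith

end FiniteChain

/-! ### Existence of a potential. -/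

/-- Extends a finite window by `true`. -/
def extendWindow {L : ℕ} (w : Fin L → Bool) (i : ℕ) : Bool := if h : i < L then w ⟨i, h⟩ else true

theorem extendWindow_restrict {L : ℕ} (u : ℕ → Bool) :
    ∀ i < L, extendWindow (fun j : Fin L => u j) i = u i := by
  intro i hi
  simp [extendWindow, hi]

/-- Only `L` entries of the infinite history matter. This is what lets later arguments pick extremal
histories. -/
theorem IsPotential.finite_range {L : ℕ} {p q v : ℝ} {H : (ℕ → Bool) → ℝ}
    (hH : IsPotential L p q v H) : (Set.range H).Finite := by
  refine (Set.finite_range fun w : Fin L → Bool => H (extendWindow w)).subset ?_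
  rintro _ ⟨u, rfl⟩
  exact ⟨fun j => u j, hH.congr _ _ (extendWindow_restrict u)⟩

theorem exists_isPotential (L : ℕ) {p q : ℝ} (hp0 : 0 < p) (hp1 : p < 1) (hq0 : 0 < q)
    (hq1 : q < 1) : ∃ v H, IsPotential L p q v H := by
  let nxt : Bool → (Fin L → Bool) → (Fin L → Bool) := fun b w j => push b (extendWindow w) j
  -- After `L` right steps the old window is forgotten.
  have hreach : ∀ w, (nxt true)^[L] w = fun _ => true := by
    intro w
    have : ∀ n, ∀ j : Fin L, j.1 < n → (nxt true)^[n] w j = true := by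
      intro n
      induction n with
      | zero => intro j hj; omega
      | succ n ih =>
        intro j hj
        rw [Function.iterate_succ_apply']
        obtain ⟨_ | j, hjL⟩ := j
        · rfl
        · have hj' : j < L := by omega
          simpa [nxt, extendWindow, hj'] using ih ⟨j, hj'⟩ (by simpa using hj)
    ext j
    exact this L j j.2
  obtain ⟨h, v, hv⟩ := exists_poisson (fun w : Fin L → Bool => upProb L p q (extendWindow w)) nxt
    (fun w => upProb_pos hp0 hq0 _) (fun w => upProb_lt_one hp1 hq1 _) L _ hreach
    (fun w => 2 * upProb L p q (extendWindow w) - 1)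
  refine ⟨v, fun u => h fun j => u j, ⟨fun w w' hw => ?_, fun u => ?_⟩⟩
  · congr 1
    ext j
    exact hw j j.2
  · have e := hv fun j => u j
    have hn : ∀ b, nxt b (fun j => u j) = fun j : Fin L => push b u j := by
      intro b
      ext j
      exact push_congr (extendWindow_restrict u) j (by omega)
    simp only [hn, upProb_congr (extendWindow_restrict u)] at e
    linarith

theorem stepSign_eq (b : Bool) : stepSign b = 1 ∨ stepSign b = -1 := by cases b <;> simp

theorem not_windowMax_and_windowMin {L : ℕ} (hL : 1 ≤ L) {w : ℕ → Bool} (h : WindowMax L w) :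
    ¬ WindowMin L w := by
  intro h'
  have h1 := h 1 hL
  have h2 := h' 1 hL
  have h3 : climb w 1 = stepSign (w 0) := by simp [climb]
  rcases stepSign_eq (w 0) with h4 | h4 <;> omega

theorem upProb_max {L : ℕ} {p q : ℝ} {w : ℕ → Bool} (h : WindowMax L w) :
    upProb L p q w = p := if_pos h

theorem upProb_min {L : ℕ} (hL : 1 ≤ L) {p q : ℝ} {w : ℕ → Bool} (h : WindowMin L w) :
    upProb L p q w = q := by
  unfold upProb
  rw [if_neg fun h' => not_windowMax_and_windowMin hL h' h, if_pos h]

theorem upProb_neutral {L : ℕ} {p q : ℝ} {w : ℕ → Bool} (h : ¬ WindowMax L w)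
    (h' : ¬ WindowMin L w) : upProb L p q w = 1 / 2 := by
  unfold upProb
  rw [if_neg h, if_neg h']

/-! ### Reflection and the symmetric case. -/

/-- The reflected history. -/
def reflect (w : ℕ → Bool) (i : ℕ) : Bool := !(w i)

theorem reflect_reflect (w : ℕ → Bool) : reflect (reflect w) = w := by
  ext i; simp [reflect]

theorem push_reflect (b : Bool) (w : ℕ → Bool) : push b (reflect w) = reflect (push (!b) w) := by
  ext (_ | i) <;> simp [reflect]

theorem climb_reflect (w : ℕ → Bool) (m : ℕ) : climb (reflect w) m = - climb w m := by
  unfold climb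
  rw [← Finset.sum_neg_distrib]
  refine Finset.sum_congr rfl fun i _ => ?_
  unfold reflect
  cases w i <;> simp

theorem windowMax_reflect {L : ℕ} {w : ℕ → Bool} : WindowMax L (reflect w) ↔ WindowMin L w :=
  forall₂_congr fun m _ => by rw [climb_reflect]; omega

theorem windowMin_reflect {L : ℕ} {w : ℕ → Bool} : WindowMin L (reflect w) ↔ WindowMax L w :=
  forall₂_congr fun m _ => by rw [climb_reflect]; omega

theorem upProb_reflect {L : ℕ} (hL : 1 ≤ L) (c : ℝ) (w : ℕ → Bool) :
    upProb L (1 - c) c (reflect w) = 1 - upProb L (1 - c) c w := by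
  by_cases h1 : WindowMax L w
  · rw [upProb_max h1, upProb_min hL (windowMin_reflect.2 h1)]; ring
  by_cases h2 : WindowMin L w
  · rw [upProb_min hL h2, upProb_max (windowMax_reflect.2 h2)]
  rw [upProb_neutral h1 h2, upProb_neutral (mt windowMax_reflect.1 h2)
    (mt windowMin_reflect.1 h1)]
  norm_num

/-- In the symmetric case `p + q = 1` there is an antisymmetric potential with zero drift. -/
theorem exists_antisymm_potential {L : ℕ} (hL : 1 ≤ L) {c : ℝ} (hc0 : 0 < c) (hc1 : c < 1) :
    ∃ H, IsPotential L (1 - c) c 0 H ∧ ∀ w, H (reflect w) = - H w := by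
  obtain ⟨v, H, hH⟩ := exists_isPotential L (p := 1 - c) (q := c) (by linarith) (by linarith)
    hc0 hc1
  -- The constant `v` cancels when the Poisson equations at `w` and at `reflect w` are subtracted.
  refine ⟨fun w => (H w - H (reflect w)) / 2, ⟨fun w w' h => ?_, fun w => ?_⟩, fun w => ?_⟩
  · simp only [hH.congr w w' h, hH.congr (reflect w) (reflect w') fun i hi => by
      simp [reflect, h i hi]]
  · have h1 := hH.eq w
    have h2 := hH.eq (reflect w)
    rw [upProb_reflect hL, push_reflect, push_reflect] at h2
    simp only [Bool.not_true, Bool.not_false] at h2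
    linarith
  · simp only [reflect_reflect]; ring

/-- The gain from stepping right rather than left, measured by a potential. -/
def advantage (H : (ℕ → Bool) → ℝ) (w : ℕ → Bool) : ℝ := 2 + H (push true w) - H (push false w)

theorem advantage_reflect {H : (ℕ → Bool) → ℝ} (hH : ∀ w, H (reflect w) = - H w) (w : ℕ → Bool) :
    advantage H (reflect w) = advantage H w := by
  unfold advantage
  rw [push_reflect, push_reflect, hH, hH]
  simp only [Bool.not_true, Bool.not_false]
  ring

theorem IsPotential.eq_up {L : ℕ} {p q v : ℝ} {H : (ℕ → Bool) → ℝ} (hH : IsPotential L p q v H)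
    {w : ℕ → Bool} : (1 - upProb L p q w) * advantage H w = 1 + H (push true w) - H w - v := by
  have := hH.eq w
  unfold advantage
  linarith

/-! ### Monotone coupling for `c ≤ 1/2`. -/

section Monotone

theorem climb_mono {w w' : ℕ → Bool} (h : ∀ i, w i = true → w' i = true) (m : ℕ) :
    climb w m ≤ climb w' m := by
  refine Finset.sum_le_sum fun i _ => ?_
  have := h i
  revert this
  cases w i <;> cases w' i <;> simp

/-- Turning left steps into right steps moves a history from minimal through neutral to maximal, and
`c ≤ 1 / 2 ≤ 1 - c`. -/
theorem upProb_mono {L : ℕ} (hL : 1 ≤ L) {c : ℝ} (hc : c ≤ 1 / 2) {w w' : ℕ → Bool}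
    (h : ∀ i, w i = true → w' i = true) :
    upProb L (1 - c) c w ≤ upProb L (1 - c) c w' := by
  have hmax : WindowMax L w → WindowMax L w' := fun hw m hm => (hw m hm).trans (climb_mono h m)
  have hmin : WindowMin L w' → WindowMin L w := fun hw m hm => (climb_mono h m).trans (hw m hm)
  by_cases h1 : WindowMax L w
  · rw [upProb_max h1, upProb_max (hmax h1)]
  by_cases h2 : WindowMin L w'
  · rw [upProb_min hL h2, upProb_min hL (hmin h2)]
  have h3 : upProb L (1 - c) c w ≤ 1 / 2 := by
    by_cases h4 : WindowMin L w
    · rwa [upProb_min hL h4]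
    · rw [upProb_neutral h1 h4]
  have h5 : 1 / 2 ≤ upProb L (1 - c) c w' := by
    by_cases h6 : WindowMax L w'
    · rw [upProb_max h6]; linarith
    · rw [upProb_neutral h6 h2]
  exact h3.trans h5

/-- If extremal steps are self-reinforcing, then the potential is monotone in the history. -/
theorem IsPotential.mono {L : ℕ} (hL : 1 ≤ L) {c : ℝ} (hc0 : 0 < c) (hc : c ≤ 1 / 2)
    {H : (ℕ → Bool) → ℝ} (hH : IsPotential L (1 - c) c 0 H) {w w' : ℕ → Bool}
    (h : ∀ i, w i = true → w' i = true) : H w ≤ H w' := by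
  let T : Set ℝ := {x | ∃ w w' : ℕ → Bool, (∀ i, w i = true → w' i = true) ∧ x = H w' - H w}
  have hT : T.Finite := by
    refine (Set.Finite.image2 (fun x y : ℝ => x - y) hH.finite_range hH.finite_range).subset ?_
    rintro _ ⟨w, w', -, rfl⟩
    exact ⟨_, ⟨w', rfl⟩, _, ⟨w, rfl⟩, rfl⟩
  obtain ⟨x, hxT, hx⟩ := Set.exists_min_image T id hT ⟨_, w, w', h, rfl⟩
  simp only [id] at hx
  have hpush : ∀ (b b' : Bool) (u u' : ℕ → Bool), (b = true → b' = true) →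
      (∀ i, u i = true → u' i = true) → ∀ i, push b u i = true → push b' u' i = true := by
    rintro b b' u u' hb hu (_ | i)
    · exact hb
    · exact hu i
  by_contra! hlt
  have hx0 : x < 0 := (hx _ ⟨w, w', h, rfl⟩).trans_lt (by linarith)
  -- Coupling the next steps writes `H u' - H u` as an average of successor differences, plus a
  -- nonnegative term. At the minimal difference `x`, the pair after two right steps must therefore
  -- again be minimal. After `L` such steps the windows agree, contradicting `x < 0`.
  have key : ∀ n, ∃ u u' : ℕ → Bool, (∀ i, u i = true → u' i = true) ∧ x = H u' - H u ∧
      ∀ i < n, u i = u' i := by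
    intro n
    induction n with
    | zero =>
      obtain ⟨u, u', hu, he⟩ := hxT
      exact ⟨u, u', hu, he, fun i hi => absurd hi (by omega)⟩
    | succ n ih =>
      obtain ⟨u, u', hu, he, hn⟩ := ih
      refine ⟨push true u, push true u', hpush _ _ _ _ id hu, ?_, push_congr hn⟩
      have e := hH.eq u
      have e' := hH.eq u'
      have h1 := hx _ ⟨push true u, push true u', hpush _ _ _ _ id hu, rfl⟩
      have h2 := hx _ ⟨push false u, push false u', hpush _ _ _ _ id hu, rfl⟩
      have h3 := hx _ ⟨push false u, push true u', hpush _ _ _ _ (by simp) hu, rfl⟩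
      have hm := upProb_mono hL hc hu
      have hr0 : 0 < upProb L (1 - c) c u := upProb_pos (by linarith) hc0 u
      have hr1 : upProb L (1 - c) c u' < 1 := upProb_lt_one (by linarith) (by linarith) u'
      generalize upProb L (1 - c) c u = r at *
      generalize upProb L (1 - c) c u' = r' at *
      refine le_antisymm h1 ?_
      by_contra! hgt
      have t1 := mul_pos hr0 (sub_pos.2 hgt)
      have t2 := mul_nonneg (sub_nonneg.2 hr1.le) (sub_nonneg.2 h2)
      have t3 := mul_nonneg (sub_nonneg.2 hm) (sub_nonneg.2 h3)
      nlinarith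
  obtain ⟨u, u', -, he, hn⟩ := key L
  rw [hH.congr u u' hn] at he
  linarith

end Monotone

/-! ### Discrepancies and the case `c > 1/2`. -/

section Repelling

/-- The history `w` followed by the steps of `F`, the newest step being the head of `F`. -/
def appendSteps (F : List Bool) (w : ℕ → Bool) : ℕ → Bool := F.foldr push w

@[simp] theorem appendSteps_nil (w : ℕ → Bool) : appendSteps [] w = w := rfl

@[simp] theorem appendSteps_cons (b : Bool) (F : List Bool) (w : ℕ → Bool) :
    appendSteps (b :: F) w = push b (appendSteps F w) := rfl

theorem appendSteps_append (G F : List Bool) (w : ℕ → Bool) :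
    appendSteps (G ++ F) w = appendSteps G (appendSteps F w) := by
  simp [appendSteps, List.foldr_append]

theorem appendSteps_agree (F : List Bool) (w w' : ℕ → Bool) :
    ∀ i < F.length, appendSteps F w i = appendSteps F w' i := by
  induction F with
  | nil => intro i hi; simp at hi
  | cons b F ih => exact push_congr ih

theorem climb_appendSteps (F : List Bool) (w : ℕ → Bool) (j : ℕ) :
    climb (appendSteps F w) (F.length + j) =
      climb (appendSteps F w) F.length + climb w j := by
  induction F with
  | nil => simp
  | cons b F ih =>
    rw [appendSteps_cons, List.length_cons, add_right_comm, climb_push, climb_push, ih, add_assoc]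

theorem climb_appendSteps_congr (F : List Bool) (w w' : ℕ → Bool) {m : ℕ} (hm : m ≤ F.length) :
    climb (appendSteps F w) m = climb (appendSteps F w') m :=
  climb_congr fun i hi => appendSteps_agree F w w' i (hi.trans_le hm)

/-- When `w` ends at a maximum, looking back beyond `F` imposes nothing new, so `u` is an arbitrary
filler. -/
theorem windowMax_appendSteps_iff {L : ℕ} (F : List Bool) {w : ℕ → Bool}
    (hw : ∀ m ≤ L, 0 ≤ climb w m) (u : ℕ → Bool) :
    WindowMax L (appendSteps F w) ↔ ∀ m ≤ L, m ≤ F.length → 0 ≤ climb (appendSteps F u) m := by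
  constructor
  · intro h m hm hmF
    rw [climb_appendSteps_congr F u w hmF]
    exact h m hm
  · intro h m hm
    rcases le_total m F.length with hmF | hmF
    · rw [climb_appendSteps_congr F w u hmF]
      exact h m hm hmF
    · obtain ⟨j, rfl⟩ := Nat.exists_eq_add_of_le hmF
      rw [climb_appendSteps, climb_appendSteps_congr F w u le_rfl]
      exact add_nonneg (h _ (by omega) le_rfl) (hw j (by omega))

theorem windowMax_push_true {L : ℕ} {w : ℕ → Bool} (hw : WindowMax L w) :
    WindowMax L (push true w) := by
  rintro (_ | m) hm
  · simp
  · rw [climb_push]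
    have := hw m (by omega)
    simp only [stepSign_true]
    omega

theorem windowMax_appendSteps_push {L : ℕ} (F : List Bool) {w : ℕ → Bool} (hw : WindowMax L w) :
    WindowMax L (appendSteps F (push true w)) ↔ WindowMax L (appendSteps F w) := by
  rw [windowMax_appendSteps_iff F (windowMax_push_true hw) w, windowMax_appendSteps_iff F hw w]

/-- The extra right step raises the current position by one over the older ones and shifts their age
by one. A single step changes the height by at most that amount. -/
theorem WindowMin.of_appendSteps_push {L : ℕ} {F : List Bool} {w : ℕ → Bool}
    (h : WindowMin L (appendSteps F (push true w))) : WindowMin L (appendSteps F w) := by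
  intro m hm
  rcases le_total m F.length with hmF | hmF
  · rw [climb_appendSteps_congr F w (push true w) hmF]
    exact h m hm
  · obtain ⟨j, rfl⟩ := Nat.exists_eq_add_of_le hmF
    have h1 := h _ hm
    rw [climb_appendSteps] at h1 ⊢
    rw [climb_appendSteps_congr F w (push true w) le_rfl]
    rcases j with _ | j
    · simpa using h1
    · rw [climb_push] at h1
      rw [climb_succ]
      rcases stepSign_eq (w j) with h2 | h2 <;> simp only [stepSign_true] at h1 <;> omega

/-- After the common steps `F`, the walk without the extra right step is at a minimum, but the walk
with the extra right step is not. -/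
def Discrepancy (L : ℕ) (w : ℕ → Bool) (F : List Bool) : Prop :=
  WindowMin L (appendSteps F w) ∧ ¬ WindowMin L (appendSteps F (push true w))

/-- The extra step raises a nonpositive climb by one and makes it positive, so that climb was `0`.
The `+ 1` in the age accounts for the extra step. -/
theorem Discrepancy.exists_return {L : ℕ} {w : ℕ → Bool} {F : List Bool}
    (h : Discrepancy L w F) :
    ∃ i, F.length + i + 1 ≤ L ∧ climb (appendSteps F w) (F.length + i) = 0 := by
  obtain ⟨h1, h2⟩ := h
  unfold WindowMin at h2
  push Not at h2
  obtain ⟨m, hm, hpos⟩ := h2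
  rcases le_total m F.length with hmF | hmF
  · rw [climb_appendSteps_congr F _ w hmF] at hpos
    exact absurd (h1 m hm) (by omega)
  · obtain ⟨j, rfl⟩ := Nat.exists_eq_add_of_le hmF
    rw [climb_appendSteps, climb_appendSteps_congr F _ w le_rfl] at hpos
    rcases j with _ | i
    · have := h1 _ hm
      simp only [add_zero, climb_zero] at hpos this
      omega
    · rw [climb_push, stepSign_true] at hpos
      refine ⟨i, hm, ?_⟩
      have := h1 (F.length + i) (by omega)
      rw [climb_appendSteps] at this ⊢
      omega

/-- There is no further discrepancy after a discrepancy followed by a left step. -/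
theorem Discrepancy.not_after_left {L : ℕ} {w : ℕ → Bool} {F : List Bool}
    (h : Discrepancy L w F) (G : List Bool) : ¬ Discrepancy L w (G ++ false :: F) := by
  intro h'
  obtain ⟨i, hi, h0⟩ := h'.exists_return
  set u := appendSteps F w
  have e : appendSteps (G ++ false :: F) w = appendSteps G (push false u) := by
    rw [appendSteps_append, appendSteps_cons]
  have hmin : WindowMin L (appendSteps G (push false u)) := e ▸ h'.1
  rw [e] at h0
  simp only [List.length_append, List.length_cons] at hi h0
  have e2 : G.length + (F.length + 1) + i = G.length + (F.length + i + 1) := by omega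
  rw [e2, climb_appendSteps, climb_push, stepSign_false] at h0
  -- The left step goes strictly below the earlier minimum. A later minimum is no higher than that,
  -- so it cannot be level with a position preceding `F`.
  have h2 : climb u (F.length + i) ≤ 0 := h.1 (F.length + i) (by omega)
  have h3 := hmin G.length (by omega)
  omega

/-- The gain from an extra right step, after the further common steps `F`. -/
def gain (H : (ℕ → Bool) → ℝ) (w : ℕ → Bool) (F : List Bool) : ℝ :=
  1 + H (appendSteps F (push true w)) - H (appendSteps F w)

variable {L : ℕ} {c : ℝ} {H : (ℕ → Bool) → ℝ} {w : ℕ → Bool}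

/-- The window has forgotten the extra step; only its displacement `1` remains. -/
theorem gain_of_length_le (hH : IsPotential L (1 - c) c 0 H) {F : List Bool}
    (hF : L ≤ F.length) : gain H w F = 1 := by
  unfold gain
  rw [hH.congr (appendSteps F (push true w)) (appendSteps F w)
    fun i hi => appendSteps_agree F _ _ i (hi.trans_le hF)]
  ring

/-- Both walks have the same step probability here, so they can move together. -/
theorem gain_of_not_discrepancy (hL : 1 ≤ L) (hH : IsPotential L (1 - c) c 0 H)
    (hw : WindowMax L w) {F : List Bool} (hF : ¬ Discrepancy L w F) :
    gain H w F = upProb L (1 - c) c (appendSteps F w) * gain H w (true :: F) +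
      (1 - upProb L (1 - c) c (appendSteps F w)) * gain H w (false :: F) := by
  have hr : upProb L (1 - c) c (appendSteps F (push true w)) =
      upProb L (1 - c) c (appendSteps F w) := by
    by_cases h1 : WindowMax L (appendSteps F w)
    · rw [upProb_max h1, upProb_max ((windowMax_appendSteps_push F hw).2 h1)]
    by_cases h2 : WindowMin L (appendSteps F w)
    · have h3 : WindowMin L (appendSteps F (push true w)) := by
        by_contra h3
        exact hF ⟨h2, h3⟩
      rw [upProb_min hL h2, upProb_min hL h3]
    rw [upProb_neutral h1 h2, upProb_neutral (mt (windowMax_appendSteps_push F hw).1 h1)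
      (mt WindowMin.of_appendSteps_push h2)]
  have e := hH.eq (appendSteps F (push true w))
  have e' := hH.eq (appendSteps F w)
  rw [hr] at e
  simp only [gain, appendSteps_cons]
  linarith

/-- The walk with the extra step is neutral and the other steps right with probability `c`; the last
term corrects for the difference. -/
theorem gain_of_discrepancy (hL : 1 ≤ L) (hH : IsPotential L (1 - c) c 0 H)
    (hw : WindowMax L w) {F : List Bool} (hF : Discrepancy L w F) :
    gain H w F = (gain H w (true :: F) + gain H w (false :: F)) / 2 -
      (c - 1 / 2) * advantage H (appendSteps F w) := by
  have h1 : ¬ WindowMax L (appendSteps F w) := fun h => not_windowMax_and_windowMin hL h hF.1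
  have e := hH.eq (appendSteps F (push true w))
  have e' := hH.eq (appendSteps F w)
  rw [upProb_neutral (mt (windowMax_appendSteps_push F hw).1 h1) hF.2] at e
  rw [upProb_min hL hF.1] at e'
  simp only [gain, appendSteps_cons, advantage]
  linarith

/-- With no discrepancy left, the gain is an average of terminal values `1`. The induction is on the
number of steps still needed to fill the window. -/
theorem gain_after_discrepancy (hL : 1 ≤ L) (hH : IsPotential L (1 - c) c 0 H)
    (hw : WindowMax L w) {F : List Bool} (hF : Discrepancy L w F) (n : ℕ) :
    ∀ G : List Bool, L ≤ G.length + n → gain H w (G ++ false :: F) = 1 := by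
  induction n with
  | zero =>
    intro G hG
    exact gain_of_length_le hH (by simp; omega)
  | succ n ih =>
    intro G hG
    rw [gain_of_not_discrepancy hL hH hw (hF.not_after_left G), ← List.cons_append,
      ← List.cons_append, ih _ (by simp; omega), ih _ (by simp; omega)]
    ring

/-- At a discrepancy the left branch has gain exactly `1` and the right branch has weight `1/2`, so
the error obeys `2 * B / 2 + B = 2 * B` and does not accumulate. The sign `ε` gives upper and lower
bounds at once. -/
theorem gain_bound (hL : 1 ≤ L) (hc0 : 0 < c) (hc1 : c < 1) (hH : IsPotential L (1 - c) c 0 H)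
    (hw : WindowMax L w) {ε B : ℝ} (hB : 0 ≤ B)
    (hA : ∀ u, WindowMin L u → ε * ((c - 1 / 2) * advantage H u) ≤ B) (n : ℕ) :
    ∀ F : List Bool, L ≤ F.length + n → -(2 * B) ≤ ε * (gain H w F - 1) := by
  induction n with
  | zero =>
    intro F hF
    rw [gain_of_length_le hH (by omega)]
    simp; linarith
  | succ n ih =>
    intro F hF
    have h1 := ih (true :: F) (by simp; omega)
    have h2 := ih (false :: F) (by simp; omega)
    by_cases hd : Discrepancy L w F
    · rw [gain_of_discrepancy hL hH hw hd]
      have h3 : gain H w (false :: F) = 1 :=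
        gain_after_discrepancy hL hH hw hd L [] (by simp)
      rw [h3]
      have h4 := hA _ hd.1
      linarith
    · rw [gain_of_not_discrepancy hL hH hw hd]
      have hr0 : 0 < upProb L (1 - c) c (appendSteps F w) := upProb_pos (by linarith) hc0 _
      have hr1 : upProb L (1 - c) c (appendSteps F w) < 1 :=
        upProb_lt_one (by linarith) (by linarith) _
      generalize upProb L (1 - c) c (appendSteps F w) = r at *
      have h3 := mul_le_mul_of_nonneg_left h1 hr0.le
      have h4 := mul_le_mul_of_nonneg_left h2 (sub_nonneg.2 hr1.le)
      linarith

theorem gain_nil (hH : IsPotential L (1 - c) c 0 H) (hw : WindowMax L w) :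
    gain H w [] = c * advantage H w := by
  have := hH.eq_up (w := w)
  rw [upProb_max hw] at this
  simp only [gain, appendSteps_nil]
  linarith

theorem windowMax_of_forall_true {u : ℕ → Bool} (hu : ∀ i < L, u i = true) : WindowMax L u := by
  intro m hm
  refine Finset.sum_nonneg fun i hi => ?_
  rw [hu i ((Finset.mem_range.1 hi).trans_le hm)]
  simp

theorem advantage_pos_of_half_lt (hL : 1 ≤ L) (hc : 1 / 2 < c) (hc1 : c < 1)
    (hH : IsPotential L (1 - c) c 0 H) (hanti : ∀ w, H (reflect w) = - H w)
    (hw : WindowMax L w) : 0 < advantage H w := by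
  let T : Set ℝ := {x | ∃ u, WindowMax L u ∧ advantage H u = x}
  have hT : T.Finite := by
    refine (Set.Finite.image2 (fun x y : ℝ => 2 + x - y) hH.finite_range hH.finite_range).subset ?_
    rintro _ ⟨u, -, rfl⟩
    exact ⟨_, ⟨_, rfl⟩, _, ⟨_, rfl⟩, rfl⟩
  have hTne : T.Nonempty := ⟨_, w, hw, rfl⟩
  obtain ⟨_, ⟨u, hu, rfl⟩, hmin⟩ := Set.exists_min_image T id hT hTne
  obtain ⟨_, ⟨x, hx, rfl⟩, hmax⟩ := Set.exists_max_image T id hT hTne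
  have hmin' : ∀ y, WindowMax L y → advantage H u ≤ advantage H y :=
    fun y hy => hmin _ ⟨y, hy, rfl⟩
  have hmax' : ∀ y, WindowMin L y → advantage H y ≤ advantage H x := fun y hy => by
    rw [← advantage_reflect hanti]
    exact hmax _ ⟨_, windowMax_reflect.2 hy, rfl⟩
  have hmin'' : ∀ y, WindowMin L y → advantage H u ≤ advantage H y := fun y hy => by
    rw [← advantage_reflect hanti y]
    exact hmin' _ (windowMax_reflect.2 hy)
  refine lt_of_lt_of_le ?_ (hmin' w hw)
  by_contra! hneg
  have hc0 : 0 < c := by linarith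
  set m := advantage H u
  set M := advantage H x
  -- With `m` and `M` the extreme advantages, `b1` gives `c * M ≤ 1 - (2 * c - 1) * m` and `b2`
  -- gives `c * m ≥ 1 - (2 * c - 1) * max M 0`. The truncation keeps `B` nonnegative.
  have b1 := gain_bound hL hc0 hc1 hH hx (ε := -1) (B := -(c - 1 / 2) * m) (by nlinarith)
    (fun y hy => by nlinarith [hmin'' y hy]) L [] (by simp)
  have b2 := gain_bound hL hc0 hc1 hH hu (ε := 1) (B := (c - 1 / 2) * max M 0)
    (mul_nonneg (by linarith) (le_max_right _ _))
    (fun y hy => by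
      rw [one_mul]
      exact mul_le_mul_of_nonneg_left ((hmax' y hy).trans (le_max_left _ _)) (by linarith))
    L [] (by simp)
  rw [gain_nil hH hx] at b1
  rw [gain_nil hH hu] at b2
  change _ ≤ -1 * (c * M - 1) at b1
  change _ ≤ 1 * (c * m - 1) at b2
  have b3 : c * max M 0 ≤ 1 - (2 * c - 1) * m := by
    rcases max_cases M 0 with ⟨h, -⟩ | ⟨h, -⟩ <;> rw [h] <;> nlinarith
  have b4 : c * (1 - (2 * c - 1) * max M 0) ≤ c * (c * m) :=
    mul_le_mul_of_nonneg_left (by linarith) hc0.le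
  have b5 : (2 * c - 1) * (c * max M 0) ≤ (2 * c - 1) * (1 - (2 * c - 1) * m) :=
    mul_le_mul_of_nonneg_left b3 (by linarith)
  -- Eliminating `M` leaves `(1 - c) * (3 * c - 1) * m ≥ 1 - c > 0`, from `c ^ 2 - (2 * c - 1) ^ 2 =
  -- (1 - c) * (3 * c - 1)`.
  have b6 : (1 - c) * (3 * c - 1) * m ≤ 0 :=
    mul_nonpos_of_nonneg_of_nonpos (mul_nonneg (by linarith) (by linarith)) hneg
  nlinarith

end Repelling

/-! ### The sign of the mean drift. -/

/-- In the symmetric case, a right step from a maximum is better than a left step. -/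
theorem advantage_pos {L : ℕ} (hL : 1 ≤ L) {c : ℝ} (hc0 : 0 < c) (hc1 : c < 1)
    {H : (ℕ → Bool) → ℝ} (hH : IsPotential L (1 - c) c 0 H) (hanti : ∀ w, H (reflect w) = - H w)
    {w : ℕ → Bool} (hw : WindowMax L w) : 0 < advantage H w := by
  rcases le_or_gt c (1 / 2) with hc | hc
  · have : H (push false w) ≤ H (push true w) := by
      refine hH.mono hL hc0 hc ?_
      rintro (_ | i) h
      · rfl
      · exact h
    unfold advantage
    linarith
  · exact advantage_pos_of_half_lt hL hc hc1 hH hanti hw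

/-- A potential whose mean drift is compared with a function of one-signed drift. -/
theorem IsPotential.drift_pos {L : ℕ} {p q v ε : ℝ} (hp0 : 0 < p) (hp1 : p < 1) (hq0 : 0 < q)
    (hq1 : q < 1) {H K D : (ℕ → Bool) → ℝ} (hH : IsPotential L p q v H)
    (hK : ∀ w w' : ℕ → Bool, (∀ i < L, w i = w' i) → K w = K w')
    (hD : ∀ w, upProb L p q w * (1 + K (push true w)) +
      (1 - upProb L p q w) * (-1 + K (push false w)) = K w + D w)
    (hD0 : ∀ w, 0 ≤ ε * D w) (hDmax : ∀ w, WindowMax L w → 0 < ε * D w) : 0 < ε * v := by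
  by_contra! hv
  -- If `ε * v ≤ 0`, then `d` is superharmonic, strictly so at maxima. Its minimizers propagate
  -- along right steps to an all-right window, which is a maximum.
  let d : (ℕ → Bool) → ℝ := fun w => ε * (H w - K w)
  have hd : ∀ w, upProb L p q w * d (push true w) + (1 - upProb L p q w) * d (push false w) =
      d w + ε * v - ε * D w := fun w => by
    have h1 := hH.eq w
    have h2 := hD w
    simp only [d]
    linear_combination ε * h1 - ε * h2
  have hT : (Set.range d).Finite := by
    refine (Set.finite_range fun w : Fin L → Bool => d (extendWindow w)).subset ?_
    rintro _ ⟨u, rfl⟩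
    refine ⟨fun j => u j, ?_⟩
    simp only [d]
    rw [hH.congr _ _ (extendWindow_restrict u), hK _ _ (extendWindow_restrict u)]
  obtain ⟨_, ⟨u, rfl⟩, hmin⟩ := Set.exists_min_image (Set.range d) id hT
    ⟨_, fun _ => true, rfl⟩
  have hmin' : ∀ w, d u ≤ d w := fun w => hmin _ ⟨w, rfl⟩
  have key : ∀ n, ∃ x : ℕ → Bool, d x = d u ∧ ∀ i < n, x i = true := by
    intro n
    induction n with
    | zero => exact ⟨u, rfl, fun i hi => absurd hi (by omega)⟩
    | succ n ih =>
      obtain ⟨x, hx, hn⟩ := ih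
      refine ⟨push true x, ?_, ?_⟩
      · refine le_antisymm ?_ (hmin' _)
        by_contra! hgt
        have hr0 : 0 < upProb L p q x := upProb_pos hp0 hq0 x
        have hr1 : upProb L p q x < 1 := upProb_lt_one hp1 hq1 x
        have h1 := hd x
        have h2 := hmin' (push false x)
        have h3 := hD0 x
        generalize upProb L p q x = r at *
        nlinarith [mul_pos hr0 (sub_pos.2 hgt),
          mul_nonneg (sub_nonneg.2 hr1.le) (sub_nonneg.2 h2)]
      · rintro (_ | i) hi
        · rfl
        · exact hn i (by omega)
  obtain ⟨x, hx, hn⟩ := key L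
  have h1 := hd x
  have h2 := hDmax x (windowMax_of_forall_true hn)
  have h3 := mul_le_mul_of_nonneg_left (hmin' (push true x)) (upProb_pos hp0 hq0 (L := L) x).le
  have h4 := mul_le_mul_of_nonneg_left (hmin' (push false x))
    (sub_nonneg.2 (upProb_lt_one hp1 hq1 (L := L) x).le)
  nlinarith

/-- The mean drift of the walk vanishes only if `p + q = 1`. -/
theorem IsPotential.drift_ne_zero {L : ℕ} (hL : 1 ≤ L) {p q v : ℝ} (hp0 : 0 < p) (hp1 : p < 1)
    (hq0 : 0 < q) (hq1 : q < 1) (hpq : p + q ≠ 1) {H : (ℕ → Bool) → ℝ}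
    (hH : IsPotential L p q v H) : v ≠ 0 := by
  obtain ⟨K, hK, hanti⟩ := exists_antisymm_potential hL hq0 hq1
  let ε : ℝ := p + q - 1
  have hε : ε ≠ 0 := fun h => hpq (by simp only [ε] at h; linarith)
  -- The drift, under parameters `p` and `q`, of position plus the potential of the walk with
  -- parameters `1 - q` and `q`.
  let D : (ℕ → Bool) → ℝ := fun w => (upProb L p q w - upProb L (1 - q) q w) * advantage K w
  have hDmax : ∀ w, WindowMax L w → 0 < ε * D w := fun w hw => by
    have : ε * D w = ε * ε * advantage K w := by
      simp only [D, upProb_max hw, ε]; ring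
    rw [this]
    exact mul_pos (mul_self_pos.2 hε) (advantage_pos hL hq0 hq1 hK hanti hw)
  have := hH.drift_pos hp0 hp1 hq0 hq1 (ε := ε) (D := D) hK.congr
    (fun w => by
      have := hK.eq w
      simp only [D, advantage]
      linear_combination this)
    (fun w => by
      by_cases hw : WindowMax L w
      · exact (hDmax w hw).le
      · have : D w = 0 := by
          simp only [D]
          by_cases hm : WindowMin L w
          · rw [upProb_min hL hm, upProb_min hL hm]; ring
          · rw [upProb_neutral hw hm, upProb_neutral hw hm]; ring
        rw [this, mul_zero])
    hDmax
  rintro rfl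
  simp at this

/-! ### Trajectories and their windows. -/

/-- A function of the trajectory depends only on the first `k + 1` positions. -/
def DependsUpTo {β : Type*} (k : ℕ) (F : (ℕ → ℤ) → β) : Prop :=
  ∀ x x' : ℕ → ℤ, (∀ i ≤ k, x i = x' i) → F x = F x'

/-- The steps before time `n`, the most recent one first; `true` is a step to the right. -/
def windowAt (x : ℕ → ℤ) (n i : ℕ) : Bool := decide (x (n - i) - x (n - (i + 1)) = 1)

theorem DependsUpTo.mono {β : Type*} {k l : ℕ} {F : (ℕ → ℤ) → β} (h : DependsUpTo k F)
    (hkl : k ≤ l) : DependsUpTo l F := fun x x' hx => h x x' fun i hi => hx i (hi.trans hkl)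

theorem dependsUpTo_windowAt (n : ℕ) : DependsUpTo n fun x => windowAt x n := by
  intro x x' h
  ext i
  simp only [windowAt, h (n - i) (by omega), h (n - (i + 1)) (by omega)]

theorem dependsUpTo_isLocalMaxAt (L k : ℕ) : DependsUpTo k fun x => IsLocalMaxAt L x k := by
  intro x x' h
  simp only [IsLocalMaxAt, h k le_rfl, fun m => h (k - m) (by omega)]

theorem dependsUpTo_isLocalMinAt (L k : ℕ) : DependsUpTo k fun x => IsLocalMinAt L x k := by
  intro x x' h
  simp only [IsLocalMinAt, h k le_rfl, fun m => h (k - m) (by omega)]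

theorem dependsUpTo_rightProb (L : ℕ) (p q : ℝ) (k : ℕ) :
    DependsUpTo k fun x => rightProb L p q x k := by
  intro x x' h
  have h1 : IsLocalMaxAt L x k ↔ IsLocalMaxAt L x' k :=
    iff_of_eq (dependsUpTo_isLocalMaxAt L k x x' h)
  have h2 : IsLocalMinAt L x k ↔ IsLocalMinAt L x' k :=
    iff_of_eq (dependsUpTo_isLocalMinAt L k x x' h)
  classical
  change rightProb L p q x k = rightProb L p q x' k
  unfold rightProb
  rw [if_congr (and_congr h1 h2) rfl (if_congr h1 rfl (if_congr h2 rfl rfl))]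

/-- A trajectory with steps `1` and `-1`. -/
def IsNearestNeighbour (x : ℕ → ℤ) : Prop := ∀ k, x (k + 1) = x k + 1 ∨ x (k + 1) = x k - 1

theorem windowAt_succ_true {x : ℕ → ℤ} {n : ℕ} (h : x (n + 1) = x n + 1) :
    windowAt x (n + 1) = push true (windowAt x n) := by
  ext (_ | i)
  · simp [windowAt, h]
  · simp [windowAt]

theorem windowAt_succ_false {x : ℕ → ℤ} {n : ℕ} (h : x (n + 1) = x n - 1) :
    windowAt x (n + 1) = push false (windowAt x n) := by
  ext (_ | i)
  · simp only [windowAt, push_zero, Nat.sub_zero, zero_add, Nat.add_sub_cancel, h,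
      decide_eq_false_iff_not]
    omega
  · simp [windowAt]

theorem climb_windowAt {x : ℕ → ℤ} (hx : IsNearestNeighbour x) {n m : ℕ} (hm : m ≤ n) :
    climb (windowAt x n) m = x n - x (n - m) := by
  induction m with
  | zero => simp
  | succ m ih =>
    rw [climb_succ, ih (by omega)]
    have e : n - m = n - (m + 1) + 1 := by omega
    have h := hx (n - (m + 1))
    rw [← e] at h
    unfold windowAt
    rcases h with h | h <;> simp [h] <;> ring

theorem isLocalMaxAt_iff {x : ℕ → ℤ} (hx : IsNearestNeighbour x) {L n : ℕ} (hn : L ≤ n) :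
    IsLocalMaxAt L x n ↔ WindowMax L (windowAt x n) := by
  unfold IsLocalMaxAt WindowMax
  rw [min_eq_left hn]
  refine forall₂_congr fun m hm => ?_
  rw [climb_windowAt hx (hm.trans hn), sub_nonneg]

theorem isLocalMinAt_iff {x : ℕ → ℤ} (hx : IsNearestNeighbour x) {L n : ℕ} (hn : L ≤ n) :
    IsLocalMinAt L x n ↔ WindowMin L (windowAt x n) := by
  unfold IsLocalMinAt WindowMin
  rw [min_eq_left hn]
  refine forall₂_congr fun m hm => ?_
  rw [climb_windowAt hx (hm.trans hn), sub_nonpos]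

/-- From time `L` on the truncation `min L k` is inactive and the window consists of genuine steps.
-/
theorem rightProb_eq_upProb {x : ℕ → ℤ} (hx : IsNearestNeighbour x) {L n : ℕ} (hL : 1 ≤ L)
    (hn : L ≤ n) (p q : ℝ) : rightProb L p q x n = upProb L p q (windowAt x n) := by
  unfold rightProb
  rw [if_neg]
  · by_cases h1 : IsLocalMaxAt L x n
    · rw [if_pos h1, upProb_max ((isLocalMaxAt_iff hx hn).1 h1)]
    rw [if_neg h1]
    by_cases h2 : IsLocalMinAt L x n
    · rw [if_pos h2, upProb_min hL ((isLocalMinAt_iff hx hn).1 h2)]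
    rw [if_neg h2, upProb_neutral (mt (isLocalMaxAt_iff hx hn).2 h1)
      (mt (isLocalMinAt_iff hx hn).2 h2)]
  · rw [isLocalMaxAt_iff hx hn, isLocalMinAt_iff hx hn]
    exact fun h => not_windowMax_and_windowMin hL h.1 h.2

/-- Step probabilities are bounded away from `0` and `1`. -/
theorem exists_le_rightProb (L : ℕ) {p q : ℝ} (hp0 : 0 < p) (hp1 : p < 1) (hq0 : 0 < q)
    (hq1 : q < 1) : ∃ ε > 0, ∀ x k, ε ≤ rightProb L p q x k ∧ ε ≤ 1 - rightProb L p q x k := by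
  refine ⟨min (min p (1 - p)) (min q (1 - q)), ?_, fun x k => ?_⟩
  · simp only [gt_iff_lt, lt_min_iff]
    refine ⟨⟨?_, ?_⟩, ?_, ?_⟩ <;> linarith
  · have a1 : min (min p (1 - p)) (min q (1 - q)) ≤ p := (min_le_left _ _).trans (min_le_left _ _)
    have a2 : min (min p (1 - p)) (min q (1 - q)) ≤ 1 - p :=
      (min_le_left _ _).trans (min_le_right _ _)
    have a3 : min (min p (1 - p)) (min q (1 - q)) ≤ q := (min_le_right _ _).trans (min_le_left _ _)
    have a4 : min (min p (1 - p)) (min q (1 - q)) ≤ 1 - q :=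
      (min_le_right _ _).trans (min_le_right _ _)
    unfold rightProb
    split_ifs <;> constructor <;> linarith

theorem IsNearestNeighbour.abs_sub_le {x : ℕ → ℤ} (hx : IsNearestNeighbour x) (k n : ℕ) :
    |x (n + k) - x k| ≤ n := by
  induction n with
  | zero => simp
  | succ n ih =>
    rw [abs_le] at ih ⊢
    have e : n + 1 + k = n + k + 1 := by omega
    rw [e]
    push_cast
    rcases hx (n + k) with h | h <;> rw [h] <;> constructor <;> linarith [ih.1, ih.2]

/-- A nearest-neighbour trajectory that is unbounded on both sides visits every site infinitely
often. -/
theorem IsNearestNeighbour.frequently_eq {x : ℕ → ℤ} (hx : IsNearestNeighbour x)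
    (ha : ¬ BddAbove (Set.range x)) (hb : ¬ BddBelow (Set.range x)) (a : ℤ) :
    ∃ᶠ n in atTop, x n = a := by
  intro hne
  obtain ⟨N, hN⟩ := eventually_atTop.1 hne
  rcases lt_or_gt_of_ne (hN N le_rfl) with h | h
  · have : ∀ n, N ≤ n → x n < a := by
      intro n hn
      induction n, hn using Nat.le_induction with
      | base => exact h
      | succ n hn ih =>
        have h1 := hN (n + 1) (by omega)
        rcases hx n with h2 | h2 <;> omega
    exact ha (IsBoundedUnder.bddAbove_range
      ⟨a, eventually_map.2 (eventually_atTop.2 ⟨N, fun n hn => (this n hn).le⟩)⟩)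
  · have : ∀ n, N ≤ n → a < x n := by
      intro n hn
      induction n, hn using Nat.le_induction with
      | base => exact h
      | succ n hn ih =>
        have h1 := hN (n + 1) (by omega)
        rcases hx n with h2 | h2 <;> omega
    exact hb (IsBoundedUnder.bddBelow_range
      ⟨a, eventually_map.2 (eventually_atTop.2 ⟨N, fun n hn => (this n hn).le⟩)⟩)

/-! ### The natural filtration and conditional probabilities. -/

section Paths

variable {Ω : Type*} {X : ℕ → Ω → ℤ}

/-- The trajectory of a process. -/
def trajectory (X : ℕ → Ω → ℤ) (ω : Ω) (i : ℕ) : ℤ := X i ω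

/-- The first `k + 1` positions of a process. -/
def initialPart (X : ℕ → Ω → ℤ) (k : ℕ) (ω : Ω) (i : Fin (k + 1)) : ℤ := X i ω

/-- Extends a finite trajectory by its last position. -/
def extendPath {k : ℕ} (z : Fin (k + 1) → ℤ) (i : ℕ) : ℤ := z ⟨min i k, by omega⟩

theorem extendPath_initialPart (k : ℕ) (ω : Ω) :
    ∀ i ≤ k, extendPath (initialPart X k ω) i = trajectory X ω i := by
  intro i hi
  simp [extendPath, initialPart, trajectory, hi]

theorem initialPart_eq_iff {k : ℕ} {ω : Ω} {z : Fin (k + 1) → ℤ} :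
    initialPart X k ω = z ↔ ∀ i ≤ k, X i ω = extendPath z i := by
  constructor
  · rintro rfl i hi
    exact (extendPath_initialPart k ω i hi).symm
  · intro h
    ext i
    have hi : i.1 ≤ k := by omega
    have := h i hi
    simpa [extendPath, hi, initialPart] using this

variable [mΩ : MeasurableSpace Ω] {P : Measure Ω}

theorem measurable_initialPart (hX : ∀ k, Measurable (X k)) (k : ℕ) :
    Measurable (initialPart X k) :=
  measurable_pi_iff.2 fun i => hX i

/-- The filtration generated by a process. -/
def pastFiltration (hX : ∀ k, Measurable (X k)) : Filtration ℕ mΩ where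
  seq k := MeasurableSpace.comap (initialPart X k) inferInstance
  mono' k l hkl := by
    have : initialPart X k =
        (fun z i => z (Fin.castLE (Nat.add_le_add_right hkl 1) i)) ∘ initialPart X l := rfl
    change MeasurableSpace.comap (initialPart X k) inferInstance ≤
      MeasurableSpace.comap (initialPart X l) inferInstance
    rw [this, ← MeasurableSpace.comap_comp]
    exact MeasurableSpace.comap_mono (measurable_pi_iff.2 fun i => measurable_pi_apply _).comap_le
  le' k := (measurable_initialPart hX k).comap_le

/-- Such a function factors through `initialPart X k`, whose values form a countable discrete space.
-/
theorem DependsUpTo.measurable {β : Type*} [MeasurableSpace β] {k : ℕ} {F : (ℕ → ℤ) → β}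
    (hF : DependsUpTo k F) (hX : ∀ k, Measurable (X k)) :
    Measurable[pastFiltration hX k] fun ω => F (trajectory X ω) := by
  have : (fun ω => F (trajectory X ω)) = (fun z => F (extendPath z)) ∘ initialPart X k := by
    ext ω
    exact hF _ _ fun i hi => (extendPath_initialPart k ω i hi).symm
  rw [this]
  exact Measurable.comp Measurable.of_discrete (comap_measurable _)

theorem DependsUpTo.stronglyMeasurable {k : ℕ} {F : (ℕ → ℤ) → ℝ}
    (hF : DependsUpTo k F) (hX : ∀ k, Measurable (X k)) :
    StronglyMeasurable[pastFiltration hX k] fun ω => F (trajectory X ω) :=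
  (hF.measurable hX).stronglyMeasurable

theorem DependsUpTo.measurableSet {k : ℕ} {Q : (ℕ → ℤ) → Prop}
    (hQ : DependsUpTo k Q) (hX : ∀ k, Measurable (X k)) :
    MeasurableSet[pastFiltration hX k] {ω | Q (trajectory X ω)} :=
  @measurableSet_setOfPred Ω (pastFiltration hX k) _ |>.2 (hQ.measurable hX)

/-- Conditional probabilities given the finite past, from the probabilities of cylinders. -/
theorem condExp_indicator_eq [IsProbabilityMeasure P] (hX : ∀ k, Measurable (X k)) (k : ℕ)
    {V : Set Ω} (hV : MeasurableSet V) {φ : (ℕ → ℤ) → ℝ} (hφ : DependsUpTo k φ)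
    {C : ℝ} (hC : ∀ x, |φ x| ≤ C)
    (h : ∀ x : ℕ → ℤ, P.real ({ω | ∀ i ≤ k, X i ω = x i} ∩ V) =
      φ x * P.real {ω | ∀ i ≤ k, X i ω = x i}) :
    (fun ω => φ (trajectory X ω)) =ᵐ[P] P[V.indicator (fun _ => (1 : ℝ)) | pastFiltration hX k] := by
  have hmeas := (hφ.stronglyMeasurable hX).mono ((pastFiltration hX).le k)
  have hint : Integrable (fun ω => φ (trajectory X ω)) P :=
    Integrable.of_bound hmeas.aestronglyMeasurable C (ae_of_all _ fun ω => hC _)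
  have hZ := measurable_initialPart hX k
  refine ae_eq_condExp_of_forall_setIntegral_eq ((pastFiltration hX).le k)
    ((integrable_const (1 : ℝ)).indicator hV) (fun s _ _ => hint.integrableOn) ?_
    (hφ.stronglyMeasurable hX).aestronglyMeasurable
  rintro _ ⟨T, hT, rfl⟩ -
  have e1 : ∫ ω in initialPart X k ⁻¹' T, φ (trajectory X ω) ∂P =
      ∫ z in T, φ (extendPath z) ∂(P.map (initialPart X k)) := by
    rw [setIntegral_map hT (Measurable.of_discrete.aestronglyMeasurable) hZ.aemeasurable]
    refine integral_congr_ae (ae_of_all _ fun ω => ?_)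
    exact hφ _ _ fun i hi => (extendPath_initialPart k ω i hi).symm
  have e2 : ∫ ω in initialPart X k ⁻¹' T, V.indicator (fun _ => (1 : ℝ)) ω ∂P =
      ∫ _z in T, (1 : ℝ) ∂((P.restrict V).map (initialPart X k)) := by
    rw [setIntegral_map hT aestronglyMeasurable_const hZ.aemeasurable,
      integral_indicator hV, Measure.restrict_restrict hV,
      Measure.restrict_restrict (hZ hT), Set.inter_comm]
  have hint' : Integrable (fun z => φ (extendPath z)) (P.map (initialPart X k)) :=
    have := Measure.isProbabilityMeasure_map (μ := P) hZ.aemeasurable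
    Integrable.of_bound Measurable.of_discrete.aestronglyMeasurable C (ae_of_all _ fun _ => hC _)
  -- Finite paths are countable, so both integrals are sums over cylinders.
  rw [e1, e2, setIntegral_countable _ T.to_countable hint'.integrableOn,
    setIntegral_countable _ T.to_countable (integrable_const _).integrableOn]
  refine tsum_congr fun z => ?_
  have hz : initialPart X k ⁻¹' {z.1} = {ω | ∀ i ≤ k, X i ω = extendPath z.1 i} := by
    ext ω
    exact initialPart_eq_iff
  rw [map_measureReal_apply hZ (measurableSet_singleton _),
    map_measureReal_apply hZ (measurableSet_singleton _),
    measureReal_restrict_apply (hZ (measurableSet_singleton _)), hz, h]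
  simp [mul_comm]

end Paths

/-! ### One-step conditional laws and conditional Borel–Cantelli. -/

section Walk

theorem cylinder_inter_step {Ω : Type*} (X : ℕ → Ω → ℤ) (k : ℕ) (s : ℤ) (x : ℕ → ℤ) :
    {ω | ∀ i ≤ k, X i ω = x i} ∩ {ω | X (k + 1) ω = X k ω + s} =
      {ω | (∀ i ≤ k, X i ω = x i) ∧ X (k + 1) ω = x k + s} := by
  ext ω
  simp only [Set.mem_inter_iff, Set.mem_ofPred_eq]
  exact and_congr_right fun h => by rw [h k le_rfl]

variable {Ω : Type*} [mΩ : MeasurableSpace Ω] {P : Measure Ω} [IsProbabilityMeasure P]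
  {L : ℕ} {p q : ℝ} {X : ℕ → Ω → ℤ}

theorem abs_rightProb_le (L : ℕ) (p q : ℝ) (x : ℕ → ℤ) (k : ℕ) :
    |rightProb L p q x k| ≤ |p| + |q| + 1 := by
  have := abs_nonneg p
  have := abs_nonneg q
  unfold rightProb
  split_ifs <;> linarith [abs_of_pos (show (0 : ℝ) < 1 / 2 by norm_num)]

theorem measurableSet_step (hX : ∀ k, Measurable (X k)) (k : ℕ) (s : ℤ) :
    MeasurableSet {ω | X (k + 1) ω = X k ω + s} :=
  measurableSet_eq_fun (hX (k + 1)) ((hX k).add_const s)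

theorem IsPerturbedWalk.condExp_right (hX : IsPerturbedWalk P L p q X) (k : ℕ) :
    (fun ω => rightProb L p q (trajectory X ω) k) =ᵐ[P]
      P[{ω | X (k + 1) ω = X k ω + 1}.indicator (fun _ => (1 : ℝ)) |
        pastFiltration hX.measurable k] := by
  refine condExp_indicator_eq hX.measurable k (measurableSet_step hX.measurable k 1)
    (dependsUpTo_rightProb L p q k) (fun x => abs_rightProb_le L p q x k) fun x => ?_
  rw [cylinder_inter_step X k, hX.step_right]

theorem IsPerturbedWalk.condExp_left (hX : IsPerturbedWalk P L p q X) (k : ℕ) :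
    (fun ω => 1 - rightProb L p q (trajectory X ω) k) =ᵐ[P]
      P[{ω | X (k + 1) ω = X k ω + (-1)}.indicator (fun _ => (1 : ℝ)) |
        pastFiltration hX.measurable k] := by
  refine condExp_indicator_eq hX.measurable k (measurableSet_step hX.measurable k (-1))
    (φ := fun x => 1 - rightProb L p q x k) (C := 1 + (|p| + |q| + 1)) (fun x x' h => ?_)
    (fun x => ?_) fun x => ?_
  · exact congrArg (1 - ·) (dependsUpTo_rightProb L p q k x x' h)
  · exact (abs_sub _ _).trans (by simpa using abs_rightProb_le L p q x k)
  · rw [cylinder_inter_step X k, ← hX.step_left]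
    rfl

/-- The conditional probabilities of the two disjoint steps add up to `1`. -/
theorem IsPerturbedWalk.ae_isNearestNeighbour (hX : IsPerturbedWalk P L p q X) :
    ∀ᵐ ω ∂P, IsNearestNeighbour (trajectory X ω) := by
  refine ae_all_iff.2 fun k => ?_
  set U := {ω | X (k + 1) ω = X k ω + 1}
  set D := {ω | X (k + 1) ω = X k ω + (-1)}
  have hU : MeasurableSet U := measurableSet_step hX.measurable k 1
  have hD : MeasurableSet D := measurableSet_step hX.measurable k (-1)
  have hr : Integrable (fun ω => rightProb L p q (trajectory X ω) k) P :=
    (integrable_congr (hX.condExp_right k)).2 integrable_condExp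
  have e1 : ∫ ω, rightProb L p q (trajectory X ω) k ∂P = P.real U := by
    rw [integral_congr_ae (hX.condExp_right k), integral_condExp, integral_indicator_const _ hU]
    simp
  have e2 : ∫ ω, (1 - rightProb L p q (trajectory X ω) k) ∂P = P.real D := by
    rw [integral_congr_ae (hX.condExp_left k), integral_condExp, integral_indicator_const _ hD]
    simp
  rw [integral_sub (integrable_const _) hr, e1] at e2
  have hdisj : Disjoint U D := by
    rw [Set.disjoint_left]
    intro ω h1 h2
    simp only [U, D, Set.mem_ofPred_eq] at h1 h2
    omega
  have h1 : P.real (U ∪ D) = 1 := by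
    rw [measureReal_union hdisj hD, ← e2]
    simp
  have h2 : ∀ᵐ ω ∂P, ω ∈ U ∪ D := by
    refine (mem_ae_iff_prob_eq_one (hU.union hD)).2 ?_
    rw [← ofReal_measureReal, h1, ENNReal.ofReal_one]
  filter_upwards [h2] with ω hω
  rcases hω with h | h
  · exact Or.inl h
  · exact Or.inr h

/-- The conditional expectation, given the past, of a function of the trajectory up to the next
step. -/
theorem IsPerturbedWalk.condExp_next (hX : IsPerturbedWalk P L p q X) (k : ℕ)
    {F U D : (ℕ → ℤ) → ℝ} (hU : DependsUpTo k U) (hD : DependsUpTo k D)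
    (hUi : Integrable (fun ω => U (trajectory X ω)) P)
    (hDi : Integrable (fun ω => D (trajectory X ω)) P)
    (hFU : ∀ x, x (k + 1) = x k + 1 → F x = U x) (hFD : ∀ x, x (k + 1) = x k - 1 → F x = D x) :
    Integrable (fun ω => F (trajectory X ω)) P ∧
    P[fun ω => F (trajectory X ω) | pastFiltration hX.measurable k] =ᵐ[P]
      fun ω => rightProb L p q (trajectory X ω) k * U (trajectory X ω) +
        (1 - rightProb L p q (trajectory X ω) k) * D (trajectory X ω) := by
  set V := {ω | X (k + 1) ω = X k ω + 1}
  have hV : MeasurableSet V := measurableSet_step hX.measurable k 1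
  set I : Ω → ℝ := V.indicator fun _ => (1 : ℝ)
  have hI : Integrable I P := (integrable_const _).indicator hV
  set u : Ω → ℝ := fun ω => U (trajectory X ω)
  set d : Ω → ℝ := fun ω => D (trajectory X ω)
  have hmul : Integrable ((u - d) * I) P := by
    have : (u - d) * I = V.indicator (u - d) := by
      ext ω
      by_cases h : ω ∈ V <;> simp [I, h]
    rw [this]
    exact (hUi.sub hDi).indicator hV
  -- Here `u` and `d` are known at time `k`, so only the indicator of a right step needs
  -- conditioning.
  have hF : (fun ω => F (trajectory X ω)) =ᵐ[P] (u - d) * I + d := by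
    filter_upwards [hX.ae_isNearestNeighbour] with ω hω
    rcases hω k with h | h
    · have h' : ω ∈ V := h
      simp [I, h', u, d, hFU _ h]
    · have h' : ω ∉ V := fun h' => by
        have h2 : trajectory X ω (k + 1) = trajectory X ω k + 1 := h'
        omega
      simp [I, h', d, hFD _ h]
  refine ⟨(integrable_congr hF).2 (hmul.add hDi), ?_⟩
  have hud : StronglyMeasurable[pastFiltration hX.measurable k] (u - d) :=
    (hU.stronglyMeasurable hX.measurable).sub (hD.stronglyMeasurable hX.measurable)
  have h1 := condExp_mul_of_stronglyMeasurable_left hud hmul hI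
  have h2 := condExp_add hmul hDi (pastFiltration hX.measurable k)
  have h3 := condExp_of_stronglyMeasurable ((pastFiltration hX.measurable).le k)
    (hD.stronglyMeasurable hX.measurable) hDi
  filter_upwards [condExp_congr_ae (m := pastFiltration hX.measurable k) hF, h1, h2,
    hX.condExp_right k] with ω a1 a2 a3 a4
  rw [a1, a3, Pi.add_apply, a2, Pi.mul_apply, ← a4, h3]
  simp only [u, d, Pi.sub_apply]
  ring

/-- A conditional Borel–Cantelli lemma: events of the past that occur infinitely often are
followed infinitely often by a prescribed step. -/
theorem IsPerturbedWalk.frequently_step (hX : IsPerturbedWalk P L p q X) (hp0 : 0 < p)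
    (hp1 : p < 1) (hq0 : 0 < q) (hq1 : q < 1) {Q : ℕ → (ℕ → ℤ) → Prop}
    (hQ : ∀ n, DependsUpTo n (Q n)) (b : Bool) :
    ∀ᵐ ω ∂P, (∃ᶠ n in atTop, Q n (trajectory X ω)) →
      ∃ᶠ n in atTop, Q n (trajectory X ω) ∧ X (n + 1) ω = X n ω + stepSign b := by
  classical
  obtain ⟨ε, hε, hr⟩ := exists_le_rightProb L hp0 hp1 hq0 hq1
  let R : ℕ → (ℕ → ℤ) → Prop := fun n x => Q n x ∧ x (n + 1) = x n + stepSign b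
  have hR : ∀ n, DependsUpTo (n + 1) (R n) := fun n x x' h => by
    simp only [R, (hQ n).mono n.le_succ x x' h, h (n + 1) le_rfl, h n n.le_succ]
  -- The index is shifted because `R n` is only decided at time `n + 1`.
  let s : ℕ → Set Ω := fun n => Nat.casesOn n ∅ fun n => {ω | R n (trajectory X ω)}
  have hs : ∀ n, MeasurableSet[pastFiltration hX.measurable n] (s n) := by
    rintro (_ | n)
    · exact @MeasurableSet.empty _ (pastFiltration hX.measurable 0)
    · exact (hR n).measurableSet hX.measurable
  have hc : ∀ k, ∀ᵐ ω ∂P,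
      (if Q k (trajectory X ω) then ε else 0) ≤
        (P[(s (k + 1)).indicator 1 | pastFiltration hX.measurable k]) ω := by
    intro k
    have hcond : ∀ b' : Bool, DependsUpTo k fun x => if Q k x ∧ b = b' then (1 : ℝ) else 0 :=
      fun b' x x' h => by simp only [hQ k x x' h]
    have hint : ∀ b' : Bool, Integrable
        (fun ω => if Q k (trajectory X ω) ∧ b = b' then (1 : ℝ) else 0) P := fun b' =>
      Integrable.of_bound (((hcond b').stronglyMeasurable hX.measurable).mono
        ((pastFiltration hX.measurable).le k)).aestronglyMeasurable 1
        (ae_of_all _ fun ω => by split_ifs <;> simp)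
    have h := (hX.condExp_next k (F := fun x => if R k x then 1 else 0) (hcond true) (hcond false)
      (hint true) (hint false)
      (fun x hx => by
        have : (x (k + 1) = x k + stepSign b) ↔ b = true := by cases b <;> simp [hx]
        simp only [R, this])
      (fun x hx => by
        have : (x (k + 1) = x k + stepSign b) ↔ b = false := by
          cases b <;> simp [hx] <;> omega
        simp only [R, this])).2
    have e : (s (k + 1)).indicator (1 : Ω → ℝ) =
        fun ω => if R k (trajectory X ω) then (1 : ℝ) else 0 := by
      ext ω
      simp [s, Set.indicator_apply]
    rw [e]
    filter_upwards [h] with ω hω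
    rw [hω]
    have := hr (trajectory X ω) k
    by_cases h1 : Q k (trajectory X ω) <;> cases b <;> simp [h1, this.1, this.2]
  filter_upwards [ae_mem_limsup_atTop_iff P hs, ae_all_iff.2 hc] with ω h1 h2 h3
  have hnn : ∀ k, 0 ≤ (P[(s (k + 1)).indicator (1 : Ω → ℝ) |
      pastFiltration hX.measurable k]) ω := fun k => by
    refine le_trans ?_ (h2 k)
    split_ifs
    exacts [hε.le, le_rfl]
  -- Conditional probabilities that are at least `ε` infinitely often are not summable.
  have h4 := (not_summable_iff_tendsto_nat_atTop_of_nonneg hnn).1 fun hsum => by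
    have h5 := hsum.tendsto_atTop_zero.eventually_lt_const hε
    obtain ⟨n, hn, hn'⟩ := (h3.and_eventually h5).exists
    have h6 := h2 n
    rw [if_pos hn] at h6
    linarith
  have h5 := mem_limsup_iff_frequently_mem.1 (h1.2 h4)
  rw [frequently_atTop] at h5 ⊢
  intro a
  obtain ⟨n, hn, hmem⟩ := h5 (a + 1)
  obtain ⟨m, rfl⟩ : ∃ m, n = m + 1 := ⟨n - 1, by omega⟩
  exact ⟨m, by omega, hmem⟩

/-- Events of the past that occur infinitely often are followed infinitely often by a prescribed
finite sequence of steps. -/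
theorem IsPerturbedWalk.frequently_steps (hX : IsPerturbedWalk P L p q X) (hp0 : 0 < p)
    (hp1 : p < 1) (hq0 : 0 < q) (hq1 : q < 1) {Q : ℕ → (ℕ → ℤ) → Prop}
    (hQ : ∀ n, DependsUpTo n (Q n)) (ζ : ℕ → Bool) (j : ℕ) :
    ∀ᵐ ω ∂P, (∃ᶠ n in atTop, Q n (trajectory X ω)) →
      ∃ᶠ n in atTop, Q n (trajectory X ω) ∧
        ∀ i < j, X (n + i + 1) ω = X (n + i) ω + stepSign (ζ i) := by
  induction j with
  | zero => exact ae_of_all _ fun ω h => by simpa using h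
  | succ j ih =>
    -- `Q` held `j` steps ago and `ζ` has been followed since; `j ≤ m` guards the natural
    -- subtraction.
    let R : ℕ → (ℕ → ℤ) → Prop := fun m x => j ≤ m ∧ Q (m - j) x ∧
      ∀ i < j, x (m - j + i + 1) = x (m - j + i) + stepSign (ζ i)
    have hR : ∀ m, DependsUpTo m (R m) := by
      intro m x x' h
      refine propext (and_congr_right fun hm => and_congr ?_ (forall₂_congr fun i hi => ?_))
      · rw [(hQ (m - j)).mono (by omega) x x' h]
      · rw [h _ (by omega), h _ (by omega)]
    filter_upwards [ih, hX.frequently_step hp0 hp1 hq0 hq1 hR (ζ j)] with ω h1 h2 h3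
    have h4 : ∃ᶠ m in atTop, R m (trajectory X ω) := by
      have h5 := h1 h3
      rw [frequently_atTop] at h5 ⊢
      intro a
      obtain ⟨n, hn, h6, h7⟩ := h5 a
      refine ⟨n + j, by omega, by omega, ?_, ?_⟩
      · rwa [Nat.add_sub_cancel]
      · rw [Nat.add_sub_cancel]
        exact h7
    have h5 := h2 h4
    rw [frequently_atTop] at h5 ⊢
    intro a
    obtain ⟨m, hm, ⟨h6, h7, h8⟩, h9⟩ := h5 (a + j)
    obtain ⟨n, rfl⟩ : ∃ n, m = n + j := ⟨m - j, by omega⟩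
    rw [Nat.add_sub_cancel] at h7 h8
    refine ⟨n, by omega, h7, fun i hi => ?_⟩
    rcases Nat.lt_succ_iff_lt_or_eq.1 hi with hi | rfl
    · exact h8 i hi
    · exact h9

end Walk

/-! ### The corrected walk. -/

theorem IsPotential.exists_abs_le {L : ℕ} {p q v : ℝ} {H : (ℕ → Bool) → ℝ}
    (hH : IsPotential L p q v H) : ∃ K, 0 ≤ K ∧ ∀ w, |H w| ≤ K := by
  obtain ⟨K, hK⟩ := (hH.finite_range.image abs).bddAbove
  have hK' : ∀ w, |H w| ≤ K := fun w => hK ⟨_, ⟨w, rfl⟩, rfl⟩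
  exact ⟨K, (abs_nonneg _).trans (hK' fun _ => true), hK'⟩

/-- The displacement since time `L`, corrected by a function of the last steps. -/
def corrected (L : ℕ) (H : (ℕ → Bool) → ℝ) (n : ℕ) (x : ℕ → ℤ) : ℝ :=
  ((x (n + L) - x L : ℤ) : ℝ) + H (windowAt x (n + L))

theorem dependsUpTo_corrected (L : ℕ) (H : (ℕ → Bool) → ℝ) (n : ℕ) :
    DependsUpTo (n + L) (corrected L H n) := by
  intro x x' h
  have hw : windowAt x (n + L) = windowAt x' (n + L) := dependsUpTo_windowAt (n + L) x x' h
  unfold corrected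
  rw [hw, h (n + L) le_rfl, h L (by omega)]

section Corrected

variable {L : ℕ} {H : (ℕ → Bool) → ℝ} {x : ℕ → ℤ} {n : ℕ}

theorem corrected_succ_right (h : x (n + L + 1) = x (n + L) + 1) :
    corrected L H (n + 1) x = corrected L H n x +
      (1 + H (push true (windowAt x (n + L))) - H (windowAt x (n + L))) := by
  unfold corrected
  rw [show n + 1 + L = n + L + 1 by omega, windowAt_succ_true h, h]
  push_cast
  ring

theorem corrected_succ_left (h : x (n + L + 1) = x (n + L) - 1) :
    corrected L H (n + 1) x = corrected L H n x +
      (-1 + H (push false (windowAt x (n + L))) - H (windowAt x (n + L))) := by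
  unfold corrected
  rw [show n + 1 + L = n + L + 1 by omega, windowAt_succ_false h, h]
  push_cast
  ring

/-- Measuring displacement from time `L` gives integrability even if the random starting point is
not integrable. -/
theorem abs_corrected_le {K : ℝ} (hK : ∀ w, |H w| ≤ K) (hx : IsNearestNeighbour x) :
    |corrected L H n x| ≤ n + K := by
  have h1 : |((x (n + L) - x L : ℤ) : ℝ)| ≤ n := by exact_mod_cast hx.abs_sub_le L n
  exact (abs_add_le _ _).trans (add_le_add h1 (hK _))

theorem abs_step_le {K s : ℝ} (hK : ∀ w, |H w| ≤ K) (hs : |s| = 1) (w w' : ℕ → Bool) :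
    |s + H w - H w'| ≤ 1 + 2 * K := by
  have h1 := abs_le.1 (hK w)
  have h2 := abs_le.1 (hK w')
  have h3 := abs_le.1 hs.le
  rw [abs_le]
  constructor <;> linarith [h1.1, h1.2, h2.1, h2.2, h3.1, h3.2]

theorem abs_corrected_succ_sub_le {K : ℝ} (hK : ∀ w, |H w| ≤ K) (hx : IsNearestNeighbour x) :
    |corrected L H (n + 1) x - corrected L H n x| ≤ 1 + 2 * K := by
  rcases hx (n + L) with h | h
  · rw [corrected_succ_right h, add_sub_cancel_left]
    exact abs_step_le hK (by simp) _ _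
  · rw [corrected_succ_left h, add_sub_cancel_left]
    exact abs_step_le hK (by simp) _ _

end Corrected

/-! ### Transience and recurrence. -/

section Walk

variable {Ω : Type*} [mΩ : MeasurableSpace Ω] {P : Measure Ω} [IsProbabilityMeasure P]
  {L : ℕ} {p q v : ℝ} {X : ℕ → Ω → ℤ} {H : (ℕ → Bool) → ℝ}

theorem IsPerturbedWalk.integrable_of_bound (hX : IsPerturbedWalk P L p q X) {k : ℕ}
    {F : (ℕ → ℤ) → ℝ} (hF : DependsUpTo k F) {C : ℝ}
    (hC : ∀ x, IsNearestNeighbour x → |F x| ≤ C) :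
    Integrable (fun ω => F (trajectory X ω)) P :=
  Integrable.of_bound ((hF.stronglyMeasurable hX.measurable).mono
    ((pastFiltration hX.measurable).le k)).aestronglyMeasurable C
    (hX.ae_isNearestNeighbour.mono fun _ hω => hC _ hω)

theorem IsPerturbedWalk.condExp_corrected (hX : IsPerturbedWalk P L p q X) (hL : 1 ≤ L)
    (hH : IsPotential L p q v H) {φ : ℝ → ℝ} (hφ : Continuous φ) (n : ℕ) :
    Integrable (fun ω => φ (corrected L H n (trajectory X ω))) P ∧
    P[fun ω => φ (corrected L H (n + 1) (trajectory X ω)) |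
      pastFiltration hX.measurable (n + L)] =ᵐ[P] fun ω =>
        upProb L p q (windowAt (trajectory X ω) (n + L)) *
          φ (corrected L H n (trajectory X ω) +
            (1 + H (push true (windowAt (trajectory X ω) (n + L))) -
              H (windowAt (trajectory X ω) (n + L)))) +
        (1 - upProb L p q (windowAt (trajectory X ω) (n + L))) *
          φ (corrected L H n (trajectory X ω) +
            (-1 + H (push false (windowAt (trajectory X ω) (n + L))) -
              H (windowAt (trajectory X ω) (n + L)))) := by
  obtain ⟨K, hK0, hK⟩ := hH.exists_abs_le
  -- The interval contains the corrected walk at time `n` and after one more step.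
  obtain ⟨C, hC⟩ := (isCompact_Icc (a := -((n : ℝ) + K + (1 + 2 * K)))
    (b := (n : ℝ) + K + (1 + 2 * K))).exists_bound_of_continuousOn hφ.continuousOn
  have hn : (0 : ℝ) ≤ n := n.cast_nonneg
  have hdep : ∀ (s : ℝ) (b : Bool), DependsUpTo (n + L) fun x => φ (corrected L H n x +
      (s + H (push b (windowAt x (n + L))) - H (windowAt x (n + L)))) := by
    intro s b x x' h
    have hw : windowAt x (n + L) = windowAt x' (n + L) := dependsUpTo_windowAt (n + L) x x' h
    simp only [hw, dependsUpTo_corrected L H n x x' h]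
  have hbd : ∀ (s : ℝ) (b : Bool), |s| = 1 → ∀ x, IsNearestNeighbour x → |φ (corrected L H n x +
      (s + H (push b (windowAt x (n + L))) - H (windowAt x (n + L))))| ≤ C := by
    intro s b hs x hx
    exact hC _ (abs_le.1 ((abs_add_le _ _).trans
      (add_le_add (abs_corrected_le hK hx) (abs_step_le hK hs _ _))))
  constructor
  · refine hX.integrable_of_bound (k := n + L) (F := fun x => φ (corrected L H n x)) (C := C)
      (fun x x' h => by simp only [dependsUpTo_corrected L H n x x' h]) fun x hx => ?_
    exact hC _ (abs_le.1 ((abs_corrected_le hK hx).trans (by linarith)))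
  · have h := (hX.condExp_next (n + L) (F := fun x => φ (corrected L H (n + 1) x))
      (hdep 1 true) (hdep (-1) false)
      (hX.integrable_of_bound (hdep 1 true) (hbd 1 true (by simp)))
      (hX.integrable_of_bound (hdep (-1) false) (hbd (-1) false (by simp)))
      (fun x hx => by rw [corrected_succ_right hx]) (fun x hx => by rw [corrected_succ_left hx])).2
    filter_upwards [h, hX.ae_isNearestNeighbour] with ω h1 h2
    rw [h1, rightProb_eq_upProb h2 hL (by omega)]

/-- A quadratic bound for the exponential of a small number. -/
theorem exp_le_one_add_add_sq {y : ℝ} (hy : |y| ≤ 1) : Real.exp y ≤ 1 + y + y ^ 2 := by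
  have := (abs_le.1 (Real.abs_exp_sub_one_sub_id_le hy)).2
  linarith

/-- Exponential moments of the corrected walk contract if the mean drift does not vanish. -/
theorem IsPerturbedWalk.exists_exp_contraction (hX : IsPerturbedWalk P L p q X) (hL : 1 ≤ L)
    (hp0 : 0 < p) (hp1 : p < 1) (hq0 : 0 < q) (hq1 : q < 1)
    (hH : IsPotential L p q v H) (hv : v ≠ 0) :
    ∃ l ρ : ℝ, 0 ≤ ρ ∧ ρ < 1 ∧ ∀ n,
      ∫ ω, Real.exp (l * corrected L H (n + 1) (trajectory X ω)) ∂P ≤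
        ρ * ∫ ω, Real.exp (l * corrected L H n (trajectory X ω)) ∂P := by
  obtain ⟨K, hK0, hK⟩ := hH.exists_abs_le
  set R : ℝ := 1 + 2 * K
  have hR : 1 ≤ R := by simp only [R]; linarith
  have hv2 : 0 < v ^ 2 := by positivity
  -- Each summand secures one of the smallness conditions `hb1`, `hb2`, `hb3` on `θ`.
  set T : ℝ := 2 * R ^ 2 + v ^ 2 + |v| * R
  have hT : 0 < T := by positivity
  set θ : ℝ := 1 / T
  have hθ : 0 < θ := by positivity
  have hθT : θ * T = 1 := by simp only [θ]; field_simp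
  have hvR : 0 ≤ |v| * R := by positivity
  have hb1 : θ * (2 * R ^ 2) ≤ 1 := hθT ▸ mul_le_mul_of_nonneg_left (by simp only [T]; linarith)
    hθ.le
  have hb2 : θ * v ^ 2 ≤ 1 := hθT ▸ mul_le_mul_of_nonneg_left
    (by simp only [T]; nlinarith [sq_nonneg R]) hθ.le
  have hb3 : θ * (|v| * R) ≤ 1 := hθT ▸ mul_le_mul_of_nonneg_left
    (by simp only [T]; nlinarith [sq_nonneg R]) hθ.le
  have hb4 : 0 < θ * v ^ 2 := by positivity
  -- The linear term of the exponential contributes `-θ * v ^ 2`, and the quadratic one costs at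
  -- most half of that.
  refine ⟨-(θ * v), 1 - θ * v ^ 2 / 2, by linarith, by linarith, fun n => ?_⟩
  have hφ : Continuous fun y : ℝ => Real.exp (-(θ * v) * y) := by fun_prop
  have h1 := (hX.condExp_corrected hL hH hφ n)
  rw [← integral_condExp ((pastFiltration hX.measurable).le (n + L)), ← integral_const_mul]
  refine integral_mono_ae integrable_condExp (h1.1.const_mul _) ?_
  filter_upwards [h1.2] with ω hω
  rw [hω]
  set w := windowAt (trajectory X ω) (n + L)
  have hr0 : 0 < upProb L p q w := upProb_pos hp0 hq0 w
  have hr1 : upProb L p q w < 1 := upProb_lt_one hp1 hq1 w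
  have he := hH.eq w
  generalize upProb L p q w = r at *
  set a := 1 + H (push true w) - H w
  set b := -1 + H (push false w) - H w
  have hab : r * a + (1 - r) * b = v := by simp only [a, b]; linarith
  have haR : |a| ≤ R := abs_step_le hK (by simp) _ _
  have hbR : |b| ≤ R := abs_step_le hK (by simp) _ _
  have key : ∀ y, |y| ≤ R → Real.exp (-(θ * v) * y) ≤ 1 - θ * v * y + θ * v ^ 2 / 2 := by
    intro y hy
    have h2 : |-(θ * v) * y| ≤ 1 := by
      rw [abs_mul, abs_neg, abs_mul, abs_of_pos hθ, mul_assoc]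
      exact (mul_le_mul_of_nonneg_left (mul_le_mul_of_nonneg_left hy (abs_nonneg v)) hθ.le).trans
        hb3
    have h3 := exp_le_one_add_add_sq h2
    have h4 : y ^ 2 ≤ R ^ 2 := sq_le_sq' (by linarith [(abs_le.1 hy).1]) (abs_le.1 hy).2
    have h5 : (-(θ * v) * y) ^ 2 ≤ θ * v ^ 2 / 2 := by
      have h6 : θ * y ^ 2 ≤ 1 / 2 := by nlinarith [mul_le_mul_of_nonneg_left h4 hθ.le]
      have h7 := mul_le_mul_of_nonneg_left h6 hb4.le
      calc (-(θ * v) * y) ^ 2 = θ * v ^ 2 * (θ * y ^ 2) := by ring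
        _ ≤ _ := by linarith
    linarith
  set S := corrected L H n (trajectory X ω)
  simp only [mul_add (-(θ * v)) S, Real.exp_add]
  have hS := Real.exp_pos (-(θ * v) * S)
  have k1 := mul_le_mul_of_nonneg_left (key a haR) hr0.le
  have k2 := mul_le_mul_of_nonneg_left (key b hbR) (sub_nonneg.2 hr1.le)
  have k3 : r * Real.exp (-(θ * v) * a) + (1 - r) * Real.exp (-(θ * v) * b) ≤
      1 - θ * v ^ 2 / 2 := by
    have : θ * v * (r * a + (1 - r) * b) = θ * v ^ 2 := by rw [hab]; ring
    linarith
  have k4 := mul_le_mul_of_nonneg_left k3 hS.le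
  linarith

/-- A walk with nonvanishing mean drift is transient. -/
theorem IsPerturbedWalk.tendsto_abs (hX : IsPerturbedWalk P L p q X) (hL : 1 ≤ L)
    (hp0 : 0 < p) (hp1 : p < 1) (hq0 : 0 < q) (hq1 : q < 1)
    (hH : IsPotential L p q v H) (hv : v ≠ 0) :
    ∀ᵐ ω ∂P, Tendsto (fun n => |X n ω|) atTop atTop := by
  obtain ⟨K, hK0, hK⟩ := hH.exists_abs_le
  obtain ⟨l, ρ, hρ0, hρ1, hstep⟩ := hX.exists_exp_contraction hL hp0 hp1 hq0 hq1 hH hv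
  set f : ℕ → Ω → ℝ := fun n ω => Real.exp (l * corrected L H n (trajectory X ω))
  have hint : ∀ n, Integrable (f n) P := fun n =>
    (hX.condExp_corrected hL hH (φ := fun y => Real.exp (l * y)) (by fun_prop) n).1
  have hgeo : ∀ n, ∫ ω, f n ω ∂P ≤ (∫ ω, f 0 ω ∂P) * ρ ^ n := by
    intro n
    induction n with
    | zero => simp
    | succ n ih =>
      calc ∫ ω, f (n + 1) ω ∂P ≤ ρ * ∫ ω, f n ω ∂P := hstep n
        _ ≤ ρ * ((∫ ω, f 0 ω ∂P) * ρ ^ n) := mul_le_mul_of_nonneg_left ih hρ0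
        _ = _ := by ring
  -- Summable means make the series of `f n` finite almost surely, so `f n` tends to `0`.
  have hsum : Summable fun n => ∫ ω, f n ω ∂P :=
    Summable.of_nonneg_of_le (fun n => integral_nonneg fun ω => (Real.exp_pos _).le) hgeo
      ((summable_geometric_of_lt_one hρ0 hρ1).mul_left _)
  have hfin : ∑' n, ∫⁻ ω, ENNReal.ofReal (f n ω) ∂P ≠ ⊤ := by
    have : ∀ n, ∫⁻ ω, ENNReal.ofReal (f n ω) ∂P = ENNReal.ofReal (∫ ω, f n ω ∂P) := fun n =>
      (ofReal_integral_eq_lintegral_ofReal (hint n)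
        (ae_of_all _ fun ω => (Real.exp_pos _).le)).symm
    simp only [this]
    exact hsum.tsum_ofReal_ne_top
  have hmeas : ∀ n, AEMeasurable (fun ω => ENNReal.ofReal (f n ω)) P := fun n =>
    (hint n).aemeasurable.ennreal_ofReal
  rw [← lintegral_tsum hmeas] at hfin
  filter_upwards [ae_lt_top' (AEMeasurable.tsum hmeas) hfin] with ω hω
  have h1 := ENNReal.tendsto_atTop_zero_of_tsum_ne_top hω.ne
  have h2 : Tendsto (fun n => f n ω) atTop (nhds 0) := by
    have := (ENNReal.tendsto_toReal ENNReal.zero_ne_top).comp h1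
    refine this.congr fun n => ?_
    simp [f, (Real.exp_pos _).le]
  have h3 : Tendsto (fun n => l * corrected L H n (trajectory X ω)) atTop atBot :=
    Real.tendsto_exp_comp_nhds_zero.1 h2
  rw [← tendsto_add_atTop_iff_nat L]
  refine tendsto_atTop.2 fun b => ?_
  -- While `|X (n + L) ω| < b`, the exponent cannot fall below this threshold.
  have hev := h3.eventually_lt_atBot (-(|l| * (|(b : ℝ)| + |(X L ω : ℝ)| + K)))
  filter_upwards [hev] with n hn
  by_contra! hlt
  have h4 : |(X (n + L) ω : ℝ)| ≤ |(b : ℝ)| := by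
    have : |X (n + L) ω| ≤ |b| := hlt.le.trans (le_abs_self b)
    exact_mod_cast this
  have h5 : |corrected L H n (trajectory X ω)| ≤ |(b : ℝ)| + |(X L ω : ℝ)| + K := by
    unfold corrected trajectory
    push_cast
    exact (abs_add_le _ _).trans (add_le_add ((abs_sub _ _).trans (by linarith)) (hK _))
  have h6 := mul_le_mul_of_nonneg_left h5 (abs_nonneg l)
  rw [← abs_mul] at h6
  linarith [neg_abs_le (l * corrected L H n (trajectory X ω))]

/-- A walk with a potential of zero drift is recurrent. -/
theorem IsPerturbedWalk.walkRecurrent (hX : IsPerturbedWalk P L p q X) (hL : 1 ≤ L)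
    (hp0 : 0 < p) (hp1 : p < 1) (hq0 : 0 < q) (hq1 : q < 1) (hH : IsPotential L p q 0 H) :
    WalkRecurrent P X := by
  obtain ⟨K, hK0, hK⟩ := hH.exists_abs_le
  let ℱ : Filtration ℕ mΩ :=
    { seq := fun n => pastFiltration hX.measurable (n + L)
      mono' := fun m n h => (pastFiltration hX.measurable).mono (Nat.add_le_add_right h L)
      le' := fun n => (pastFiltration hX.measurable).le (n + L) }
  let f : ℕ → Ω → ℝ := fun n ω => corrected L H n (trajectory X ω)
  have hcond := hX.condExp_corrected hL hH continuous_id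
  have hM : Martingale f ℱ P := by
    refine martingale_nat (fun n => (dependsUpTo_corrected L H n).stronglyMeasurable hX.measurable)
      (fun n => (hcond n).1) fun n => ?_
    filter_upwards [(hcond n).2] with ω hω
    refine Eq.trans ?_ hω.symm
    have := hH.eq (windowAt (trajectory X ω) (n + L))
    simp only [id, f]
    linarith
  have hbdd : ∀ᵐ ω ∂P, ∀ n, |f (n + 1) ω - f n ω| ≤ ((1 + 2 * K).toNNReal : ℝ) := by
    filter_upwards [hX.ae_isNearestNeighbour] with ω hω n
    rw [Real.coe_toNNReal _ (by linarith)]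
    exact abs_corrected_succ_sub_le hK hω
  intro a
  filter_upwards [hX.ae_isNearestNeighbour, hM.bddAbove_range_iff_bddBelow_range hbdd,
    hM.submartingale.bddAbove_iff_exists_tendsto hbdd,
    hX.frequently_steps hp0 hp1 hq0 hq1 (Q := fun _ _ => True) (fun _ _ _ _ => rfl)
      (fun _ => true) (L + 1)] with ω hω h1 h2 h3
  have h4 := h3 (Frequently.of_forall fun _ => trivial)
  -- The first `L` of `L + 1` right steps make the window all `true`. The last one leaves it
  -- unchanged, so the martingale jumps by exactly `1`, infinitely often, and cannot converge.
  have hnot : ¬ BddAbove (Set.range fun n => f n ω) := by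
    rw [h2]
    rintro ⟨c, hc⟩
    have h5 : Tendsto (fun n => f (n + 1) ω - f n ω) atTop (nhds 0) := by
      simpa using ((tendsto_add_atTop_iff_nat 1).2 hc).sub hc
    obtain ⟨n, ⟨-, hn⟩, hlt⟩ := (h4.and_eventually (h5.eventually_lt_const one_pos)).exists
    have h6 : trajectory X ω (n + L + 1) = trajectory X ω (n + L) + 1 := hn L L.lt_succ_self
    have h7 : ∀ i < L, windowAt (trajectory X ω) (n + L) i = true := by
      intro i hi
      have h8 := hn (L - (i + 1)) (by omega)
      rw [show n + (L - (i + 1)) + 1 = n + L - i by omega,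
        show n + (L - (i + 1)) = n + L - (i + 1) by omega] at h8
      simp [windowAt, trajectory, h8]
    have h9 := hH.congr (push true (windowAt (trajectory X ω) (n + L)))
      (windowAt (trajectory X ω) (n + L)) (by
        rintro (_ | i) hi
        · exact (h7 0 hi).symm
        · rw [h7 _ hi]
          exact h7 i (by omega))
    have h10 := corrected_succ_right (H := H) h6
    rw [h9] at h10
    simp only [f] at hlt
    linarith
  refine hω.frequently_eq (fun hb => hnot ?_) (fun hb => hnot (h1.2 ?_)) a
  · obtain ⟨B, hB⟩ := hb
    refine ⟨((B - X L ω : ℤ) : ℝ) + K, ?_⟩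
    rintro _ ⟨n, rfl⟩
    have h5 : trajectory X ω (n + L) ≤ B := hB ⟨_, rfl⟩
    refine add_le_add (Int.cast_le.2 ?_) (abs_le.1 (hK _)).2
    exact sub_le_sub_right h5 _
  · obtain ⟨B, hB⟩ := hb
    refine ⟨((B - X L ω : ℤ) : ℝ) + -K, ?_⟩
    rintro _ ⟨n, rfl⟩
    have h5 : B ≤ trajectory X ω (n + L) := hB ⟨_, rfl⟩
    refine add_le_add (Int.cast_le.2 ?_) (abs_le.1 (hK _)).1
    exact sub_le_sub_right h5 _

/-- If the walk is recurrent, then so is the chain of positions and last steps. -/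
theorem IsPerturbedWalk.chainRecurrent (hX : IsPerturbedWalk P L p q X)
    (hp0 : 0 < p) (hp1 : p < 1) (hq0 : 0 < q) (hq1 : q < 1) (h : WalkRecurrent P X) :
    ChainRecurrent P L X := by
  intro a η hη
  -- `η` lists the newest step first and `ζ` the oldest, hence the reversed index.
  let ζ : ℕ → Bool := fun i => if hi : L - 1 - i < L then decide (η ⟨L - 1 - i, hi⟩ = 1) else true
  -- The site from which the steps `ζ` lead to `a`.
  let a₀ : ℤ := a - ∑ i ∈ Finset.range L, stepSign (ζ i)
  filter_upwards [h a₀, hX.frequently_steps hp0 hp1 hq0 hq1 (Q := fun n x => x n = a₀)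
    (fun n x x' h => by simp only [h n le_rfl]) ζ L] with ω h1 h2
  have h3 := h2 h1
  rw [frequently_atTop] at h3 ⊢
  intro N
  obtain ⟨n, hn, h4, h5⟩ := h3 N
  refine ⟨n + L, by omega, by omega, ?_, ?_⟩
  · have h6 : ∀ j ≤ L, X (n + j) ω = a₀ + ∑ i ∈ Finset.range j, stepSign (ζ i) := by
      intro j hj
      induction j with
      | zero => simpa [trajectory] using h4
      | succ j ih =>
        rw [Finset.sum_range_succ, ← add_assoc a₀, ← ih (by omega)]
        exact h5 j hj
    rw [h6 L le_rfl]
    simp only [a₀]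
    ring
  · ext i
    have hi := i.2
    have h6 := h5 (L - 1 - i) (by omega)
    rw [show n + (L - 1 - i) + 1 = n + L - i by omega,
      show n + (L - 1 - i) = n + L - (i + 1) by omega] at h6
    have h7 : stepSign (ζ (L - 1 - i)) = η i := by
      have h8 : L - 1 - (L - 1 - i.1) = i := by omega
      have h9 : L - 1 - (L - 1 - i.1) < L := by omega
      have h10 : ζ (L - 1 - i) = decide (η i = 1) := by
        simp only [ζ, dif_pos h9, h8]
      rw [h10]
      rcases hη i with h11 | h11 <;> simp [h11]
    simp only [lastSteps]
    rw [h6, h7]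
    ring

end Walk

/-! ### Conclusion. -/

theorem not_frequently_eq_of_tendsto_abs {x : ℕ → ℤ} (h : Tendsto (fun n => |x n|) atTop atTop)
    (a : ℤ) : ¬ ∃ᶠ n in atTop, x n = a := by
  intro hf
  obtain ⟨n, h1, h2⟩ := (hf.and_eventually (h.eventually_gt_atTop |a|)).exists
  rw [h1] at h2
  exact lt_irrefl _ h2

theorem theorem2 {Ω : Type*} [MeasurableSpace Ω] (P : Measure Ω) [IsProbabilityMeasure P]
    (L : ℕ) (hL : 1 ≤ L) (p q : ℝ) (hp0 : 0 < p) (hp1 : p < 1) (hq0 : 0 < q) (hq1 : q < 1)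
    (X : ℕ → Ω → ℤ) (hX : IsPerturbedWalk P L p q X) :
    (WalkRecurrent P X ↔ p + q = 1) ∧
    (ChainRecurrent P L X ↔ p + q = 1) ∧
    (p + q ≠ 1 → ∀ᵐ ω ∂P, Tendsto (fun n => |X n ω|) atTop atTop) := by
  have htrans : p + q ≠ 1 → ∀ᵐ ω ∂P, Tendsto (fun n => |X n ω|) atTop atTop := by
    intro hpq
    obtain ⟨v, H, hH⟩ := exists_isPotential L hp0 hp1 hq0 hq1
    exact hX.tendsto_abs hL hp0 hp1 hq0 hq1 hH (hH.drift_ne_zero hL hp0 hp1 hq0 hq1 hpq)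
  have hrec : p + q = 1 → WalkRecurrent P X := by
    intro hpq
    obtain rfl : p = 1 - q := by linarith
    obtain ⟨H, hH, -⟩ := exists_antisymm_potential hL hq0 hq1
    exact hX.walkRecurrent hL hp0 hp1 hq0 hq1 hH
  refine ⟨⟨fun h => ?_, hrec⟩, ⟨fun h => ?_, fun hpq =>
    hX.chainRecurrent hp0 hp1 hq0 hq1 (hrec hpq)⟩, htrans⟩
  · by_contra hpq
    obtain ⟨ω, h1, h2⟩ := ((htrans hpq).and (h 0)).exists
    exact not_frequently_eq_of_tendsto_abs h1 0 h2
  · by_contra hpq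
    obtain ⟨ω, h1, h2⟩ := ((htrans hpq).and (h 0 (fun _ => 1) fun _ => Or.inl rfl)).exists
    exact not_frequently_eq_of_tendsto_abs h1 0 (h2.mono fun n hn => hn.2.1)
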